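/- For a positive integer $Q$ let $\mathfrak F_{Q,\mathrm{even}}$ (respectively $\mathfrak F_{Q,\mathrm{odd}}$) be the increasing sequence of the fractions $a/q$ with $1\le a\le q\le Q$, $\gcd(a,q)=1$ and $q$ even (respectively odd). To each pair of consecutive fractions $a'/q'<a''/q''$ in $\mathfrak F_{Q,\mathrm{even}}$ attach the point $(q'/Q,q''/Q)\in[0,1]^2$, the points being counted with multiplicity (one for each pair of consecutive fractions). For $(u,v)\in[0,1]^2$ and $\eta>0$ let $\square_\eta=(u-\eta,u+\eta)\times(v-\eta,v+\eta)$, and put $$g(u,v)=\lim_{\eta\to0^+}\frac1{4\eta^2}\,\lim_{Q\to\infty}\frac{\#\{\text{points in }\square_\eta\}}{\#\{\text{all points}\}} .$$ For conditions on two variables $z,\overline z$, let $\varphi(\text{conditions})$ be $1$ if the conditions hold for $(z,\overline z)=(u,v)$ or for $(z,\overline z)=(v,u)$, and $0$ otherwise; let $\widetilde\varphi(\text{conditions})$ be $1$ if they hold for both $(z,\overline z)=(u,v)$ and $(z,\overline z)=(v,u)$, and $0$ otherwise. Then, for all real $u,v$ with $0\le u,v\le1$, the inner limit exists for every $\eta>0$,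 the outer limit exists in $[0,\infty]$, and $$\begin{aligned} g(u,v)={}&\sum_{j=1}^\infty\frac1j\,\widetilde\varphi\Big(z<1;\ j<\frac{z+\overline z}{1-z}\Big)\\ &+\sum_{j=1}^\infty\frac1{2j}\bigg\{\varphi\Big((j+1)z+\overline z=j;\ \frac{j-1}{j+1}<z<\frac{j}{j+2}\Big)+\varphi\Big(z=1;\ \frac{j-1}{j+1}<\overline z<1\Big)\bigg\}\\ &+\sum_{j=1}^\infty\bigg\{\frac{2j+1}{8j(j+1)}\,\varphi\Big(z=\frac{j-1}{j+1};\ \overline z=1\Big)+\frac{j+2}{4j(j+1)}\,\widetilde\varphi\Big(z=\frac{j}{j+2}\Big)+\frac1{4j}\,\widetilde\varphi(z=1)\bigg\}, \end{aligned}$$ where the value at $(1,1)$ is $\infty$. The same limits exist, with the same value $g(u,v)$, when $\mathfrak F_{Q,\mathrm{even}}$ is replaced by $\mathfrak F_{Q,\mathrm{odd}}$. Moreover, if $(u,v)\in[0,1]^2$ lies on the boundary of none of the quadrilaterals $$\{(x,y)\in[0,1]^2:\ j(1-x)\le x+y,\ j(1-y)\le x+y\},\qquad j=1,2,3,\dots$$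 (these boundaries tessellate the unit square into countably many polygons), then $$g(u,v)=\sum_{\substack{j\ge1\\ j<(u+v)/(1-u),\ j<(u+v)/(1-v)}}\frac1j .$$ -/

import Mathlib

open Filter Topology
open scoped ENNReal

/-- The fractions `a / q` with `1 ≤ a ≤ q ≤ Q`, `gcd (a, q) = 1` and `q` even. -/
def evenFarey (Q : ℕ) : Finset ℚ :=
  ((Finset.Icc 1 Q ×ˢ Finset.Icc 1 Q).filter
    (fun p : ℕ × ℕ => p.1 ≤ p.2 ∧ Nat.Coprime p.1 p.2 ∧ p.2 % 2 = 0)).image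
    (fun p : ℕ × ℕ => (p.1 : ℚ) / (p.2 : ℚ))

/-- The fractions `a / q` with `1 ≤ a ≤ q ≤ Q`, `gcd (a, q) = 1` and `q` odd. -/
def oddFarey (Q : ℕ) : Finset ℚ :=
  ((Finset.Icc 1 Q ×ˢ Finset.Icc 1 Q).filter
    (fun p : ℕ × ℕ => p.1 ≤ p.2 ∧ Nat.Coprime p.1 p.2 ∧ p.2 % 2 = 1)).image
    (fun p : ℕ × ℕ => (p.1 : ℚ) / (p.2 : ℚ))

/-- The pairs `x < y` of consecutive elements of a finite set of rational numbers. -/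
def consecutivePairs (S : Finset ℚ) : Finset (ℚ × ℚ) :=
  (S ×ˢ S).filter (fun p : ℚ × ℚ => p.1 < p.2 ∧ ∀ z ∈ S, ¬ (p.1 < z ∧ z < p.2))

open Classical in
/-- The proportion of the pairs of consecutive fractions in `S`, with reduced denominators `q'`
and `q''`, for which `(q' / Q, q'' / Q)` lies in the open square of side `2 η` centred at
`(u, v)` with sides parallel to the axes. -/
noncomputable def squareProportion (S : Finset ℚ) (Q : ℕ) (u v η : ℝ) : ℝ :=
  (((consecutivePairs S).filter (fun p : ℚ × ℚ =>
      (p.1.den : ℝ) / (Q : ℝ) ∈ Set.Ioo (u - η) (u + η) ∧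
      (p.2.den : ℝ) / (Q : ℝ) ∈ Set.Ioo (v - η) (v + η))).card : ℝ) /
    ((consecutivePairs S).card : ℝ)

/-- The limiting local density at `(u, v)` of the points `(q' / Q, q'' / Q)`, for `q'`, `q''` the
denominators of consecutive fractions in `F Q`, exists and equals `d`: for each square centred at
`(u, v)` the proportion of the points in it has a limit as `Q → ∞`, and this limit divided by the
area of the square tends to `d` as the square shrinks. -/
def HasLocalDensity (F : ℕ → Finset ℚ) (u v : ℝ) (d : ℝ≥0∞) : Prop :=
  ∃ L : ℝ → ℝ,
    (∀ η : ℝ, 0 < η →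
      Tendsto (fun Q : ℕ => squareProportion (F Q) Q u v η) atTop (𝓝 (L η))) ∧
    Tendsto (fun η : ℝ => ENNReal.ofReal (L η / (2 * η) ^ 2)) (𝓝[>] 0) (𝓝 d)

open Classical in
/-- `1` if the conditions hold for `(z, z̄) = (u, v)` or for `(z, z̄) = (v, u)`, else `0`. -/
noncomputable def charEither (u v : ℝ) (P : ℝ → ℝ → Prop) : ℝ≥0∞ :=
  if P u v ∨ P v u then 1 else 0

open Classical in
/-- `1` if the conditions hold for `(z, z̄) = (u, v)` and for `(z, z̄) = (v, u)`, else `0`. -/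
noncomputable def charBoth (u v : ℝ) (P : ℝ → ℝ → Prop) : ℝ≥0∞ :=
  if P u v ∧ P v u then 1 else 0

/-- The explicit density. Here `w` is the other variable `z̄`; the value at `(1, 1)` is `∞`. -/
noncomputable def fareyDensity (u v : ℝ) : ℝ≥0∞ :=
  (∑' j : ℕ+, 1 / (j : ℝ≥0∞) *
      charBoth u v (fun z w => z < 1 ∧ (j : ℝ) < (z + w) / (1 - z))) +
  (∑' j : ℕ+, 1 / (2 * (j : ℝ≥0∞)) *
      (charEither u v (fun z w => ((j : ℝ) + 1) * z + w = (j : ℝ) ∧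
          ((j : ℝ) - 1) / ((j : ℝ) + 1) < z ∧ z < (j : ℝ) / ((j : ℝ) + 2)) +
        charEither u v (fun z w => z = 1 ∧
          ((j : ℝ) - 1) / ((j : ℝ) + 1) < w ∧ w < 1))) +
  (∑' j : ℕ+,
      ((2 * (j : ℝ≥0∞) + 1) / (8 * (j : ℝ≥0∞) * ((j : ℝ≥0∞) + 1)) *
          charEither u v (fun z w => z = ((j : ℝ) - 1) / ((j : ℝ) + 1) ∧ w = 1) +
        ((j : ℝ≥0∞) + 2) / (4 * (j : ℝ≥0∞) * ((j : ℝ≥0∞) + 1)) *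
          charBoth u v (fun z _ => z = (j : ℝ) / ((j : ℝ) + 2)) +
        1 / (4 * (j : ℝ≥0∞)) * charBoth u v (fun z _ => z = 1)))

/-- The closed quadrilateral cut out of the unit square by `j (1 - x) ≤ x + y` and
`j (1 - y) ≤ x + y`. The boundaries of these nested quadrilaterals, for `j = 1, 2, …`, are the
edges of a tessellation of the unit square. -/
def densityQuad (j : ℕ) : Set (ℝ × ℝ) :=
  {p | p.1 ∈ Set.Icc (0 : ℝ) 1 ∧ p.2 ∈ Set.Icc (0 : ℝ) 1 ∧
    (j : ℝ) * (1 - p.1) ≤ p.1 + p.2 ∧ (j : ℝ) * (1 - p.2) ≤ p.1 + p.2}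

/-!
Both parities are treated together: `parityFarey k` is the even sequence for `k = 0` and the odd
one for `k = 1`.

*The gaps.* Let `a / x` be a fraction of the sequence, regarded as the vector `w = (a, x)`. There
is exactly one integer `y` with `Q - x < 2 y ≤ Q + x` for which some vector `V = (b, 2 y)` satisfies
`b x - 2 a y = 2 - k` (where, if `k = 0`, `V` is required to be twice a primitive vector). The
next fraction is then `m V - w`, where `m` is the largest number with `2 m y - x ≤ Q`. Indeed a
fraction strictly between the two has the form `α w + β V` with `α ≠ 0`, by parity, and `β ≥ 1`,
and so its denominator exceeds `Q` (`no_fraction_between`).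
Hence, up to one exception at the right end of `(0, 1]`, the pairs of consecutive fractions
correspond to the coprime lattice points `(x, y)` in the window with `x ≡ k` modulo `2`, and the
pair of denominators is `(x, 2 m y - x)` with `m = ⌊(Q + x) / (2 y)⌋`
(`card_consecutivePairs_bounds`).

*Counting.* By Möbius inversion over the odd common divisors, the number of coprime points with
`x ≡ k` in the dilate `Q Ω` of a bounded convex set is asymptotic to `c Q² area (Ω)`, where
`c > 0` depends on `k` only (`exists_tendsto_parityCount`). The points with given `m` and with the
two denominators in a given square fill a dilated convex polygon, and the map
`(x, y) ↦ (x, 2 m y - x)`, of determinant `2 m`, carries it to `indexRegion m`. At most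
`2 Q² / m²` points belong to `m`, so the sum over `m` passes to the limit. Since the whole window has area `1 / 2`, the constant `c`
cancels, and the limiting proportion is `∑ area (indexRegion m) / m` (`tendsto_squareProportion`).

*Localization.* Apart from the restriction to the square, `indexRegion m` is the polygon given by
`x, y ≤ 1` and `m (1 - x) < x + y`, `m (1 - y) < x + y`. Its share of a small square about `(u, v)`
depends only on `m` and on which of these four constraints hold or are active at `(u, v)`; the
nonzero shares are `1`, `1 / 2`, and those of the three kinds of vertices (`tendsto_volume_indexRegion`). Away from
`(1, 1)` only finitely many `m` matter, and at `(1, 1)` every share is `1 / 4`, so that the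
harmonic series makes the density infinite.
-/

/-! ### Gaps and lattice points -/

/-- The reduced fractions in `(0, 1]` with denominator at most `Q` and congruent to `k` modulo
`2`; the values `k = 0, 1` give the even and the odd Farey fractions. -/
def parityFarey (k Q : ℕ) : Finset ℚ :=
  ((Finset.Icc 1 Q ×ˢ Finset.Icc 1 Q).filter
    (fun p : ℕ × ℕ => p.1 ≤ p.2 ∧ Nat.Coprime p.1 p.2 ∧ p.2 % 2 = k)).image
    (fun p : ℕ × ℕ => (p.1 : ℚ) / (p.2 : ℚ))

/-- The lattice points that parametrize the gaps of `parityFarey k Q`. The point `(x, y)` stands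
for the gap whose left end has denominator `x`; the vector at height `2 y` whose multiples, less
the left end, run through the possible right ends, is pinned down by the window
`Q - x < 2 y ≤ Q + x`. -/
def gapPoints (k Q : ℕ) : Finset (ℕ × ℕ) :=
  (Finset.Icc 1 Q ×ˢ Finset.Icc 1 Q).filter
    (fun p => p.1 % 2 = k ∧ Nat.Coprime p.1 p.2 ∧ Q < p.1 + 2 * p.2 ∧ 2 * p.2 ≤ Q + p.1)

/-- The denominator of the right end of the gap of `(x, y)`: the largest number at most `Q` of
the form `2 m y - x`. -/
def nextDen (Q : ℕ) (p : ℕ × ℕ) : ℕ := 2 * ((Q + p.1) / (2 * p.2)) * p.2 - p.1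

theorem mem_parityFarey {k Q : ℕ} {r : ℚ} :
    r ∈ parityFarey k Q ↔ 0 < r ∧ r ≤ 1 ∧ r.den ≤ Q ∧ r.den % 2 = k := by
  simp only [parityFarey, Finset.mem_image, Finset.mem_filter, Finset.mem_product, Finset.mem_Icc,
    Prod.exists]
  constructor
  · rintro ⟨a, q, ⟨⟨⟨ha, _⟩, hq, hqQ⟩, haq, hc, hk⟩, rfl⟩
    have hq0 : (0 : ℚ) < q := by exact_mod_cast hq
    have hden : ((a : ℚ) / (q : ℚ)).den = q := by
      have := Rat.den_div_eq_of_coprime (a := a) (b := q) (by exact_mod_cast hq) (by simpa using hc)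
      rw [Int.cast_natCast, Int.cast_natCast] at this
      exact_mod_cast this
    refine ⟨by positivity, ?_, by omega, by omega⟩
    rw [div_le_one hq0]
    exact_mod_cast haq
  · rintro ⟨h0, h1, hQ, hk⟩
    have hn : 0 < r.num := Rat.num_pos.2 h0
    have hle : r.num ≤ r.den := by
      have := Rat.le_iff r 1
      simp at this
      exact this.1 h1
    refine ⟨r.num.toNat, r.den, ⟨⟨⟨by omega, by omega⟩, r.den_pos, hQ⟩, by omega, ?_, hk⟩, ?_⟩
    · have := r.reduced
      rwa [show r.num.natAbs = r.num.toNat by omega] at this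
    · have : ((r.num.toNat : ℕ) : ℚ) = (r.num : ℚ) := by
        have : ((r.num.toNat : ℕ) : ℤ) = r.num := by omega
        exact_mod_cast this
      rw [this, Rat.num_div_den]

/-- A reduced fraction of denominator parity `k` strictly between `a / x` and the next fraction
has height above `Q`: in the basis formed by `(a, x)` and the primitive vector on the line of
`(A (2 - k), 2 y)`, the coefficient of the former is nonzero by parity. -/
theorem no_fraction_between {k Q x y a A m c d : ℤ} (hk : k = 0 ∨ k = 1) (hx : x % 2 = k)
    (hdet : A * x - (k + 1) * a * y = 1) (h1 : Q < x + 2 * y) (hx0 : 0 < x) (hy : 0 < y)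
    (h2 : Q < 2 * (m + 1) * y - x) (hm : 0 < 2 * m * y - x) (hd : d ≤ Q) (hdk : d % 2 = k)
    (hcop : IsCoprime c d)
    (hlt1 : a * d < c * x) (hlt2 : c * (2 * m * y - x) < (m * (2 - k) * A - a) * d) : False := by
  obtain ⟨α, hα⟩ : ∃ α, α = A * d - (k + 1) * y * c := ⟨_, rfl⟩
  obtain ⟨γ, hγ⟩ : ∃ γ, γ = c * x - a * d := ⟨_, rfl⟩
  have hγ0 : 0 < γ := by omega
  have hd' : d = α * x + γ * ((k + 1) * y) := by
    rw [hα, hγ]; linear_combination (-d) * hdet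
  have hc' : c = α * a + γ * A := by
    rw [hα, hγ]; linear_combination (-c) * hdet
  obtain ⟨β, hβ⟩ : ∃ β, γ = (2 - k) * β := by
    rcases hk with rfl | rfl
    · have h2x : (2 : ℤ) ∣ x := Int.dvd_of_emod_eq_zero hx
      have h2d : (2 : ℤ) ∣ d := Int.dvd_of_emod_eq_zero hdk
      obtain ⟨t, ht⟩ : (2 : ℤ) ∣ γ := by
        rw [hγ]; exact dvd_sub (h2x.mul_left _) (h2d.mul_left _)
      exact ⟨t, by rw [ht]; ring⟩
    · exact ⟨γ, by ring⟩
  have hβ0 : 0 < β := by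
    rcases hk with rfl | rfl <;> omega
  have hd2 : d = α * x + 2 * β * y := by
    rw [hd', hβ]; rcases hk with rfl | rfl <;> ring
  have hα0 : α ≠ 0 := by
    intro h0
    rcases hk with rfl | rfl
    · have h2d : (2 : ℤ) ∣ d := Int.dvd_of_emod_eq_zero hdk
      have h2c : (2 : ℤ) ∣ c := ⟨β * A, by rw [hc', h0, hβ]; ring⟩
      have := hcop.isUnit_of_dvd' h2c h2d
      rw [Int.isUnit_iff] at this
      omega
    · have : d = 2 * (β * y) := by rw [hd2, h0]; ring
      omega
  have hpos : 0 < α * m + β := by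
    have h : (m * (2 - k) * A - a) * d - c * (2 * m * y - x) = (2 - k) * (α * m + β) := by
      have e : (m * (2 - k) * A - a) * d - c * (2 * m * y - x) = (2 - k) * m * α + γ := by
        rw [hα, hγ]; rcases hk with rfl | rfl <;> ring
      rw [e, hβ]; ring
    have h' : 0 < (2 - k) * (α * m + β) := by rw [← h]; omega
    rcases hk with rfl | rfl <;> linarith
  rcases lt_or_gt_of_ne hα0 with h | h
  · have e : d = -α * (2 * m * y - x) + 2 * (α * m + β) * y := by rw [hd2]; ring
    nlinarith [mul_nonneg (show (0 : ℤ) ≤ -α - 1 by omega) hm.le,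
      mul_nonneg (show (0 : ℤ) ≤ α * m + β - 1 by omega) hy.le]
  · nlinarith [mul_nonneg (show (0 : ℤ) ≤ α - 1 by omega) hx0.le,
      mul_nonneg (show (0 : ℤ) ≤ β - 1 by omega) hy.le]


/-- The lattice point `p` belongs to the gap to the right of `r`. -/
def IsGapPoint (k : ℕ) (r : ℚ) (p : ℕ × ℕ) : Prop :=
  r.den = p.1 ∧ ∃ A : ℤ, A * p.1 - (k + 1) * r.num * p.2 = 1

theorem mem_gapPoints {k Q : ℕ} {p : ℕ × ℕ} :
    p ∈ gapPoints k Q ↔ (0 < p.1 ∧ p.1 ≤ Q) ∧ (0 < p.2 ∧ p.2 ≤ Q) ∧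
      p.1 % 2 = k ∧ Nat.Coprime p.1 p.2 ∧ Q < p.1 + 2 * p.2 ∧ 2 * p.2 ≤ Q + p.1 := by
  simp only [gapPoints, Finset.mem_filter, Finset.mem_product, Finset.mem_Icc]
  constructor
  · rintro ⟨⟨⟨a, b⟩, c, d⟩, h⟩; exact ⟨⟨a, b⟩, ⟨c, d⟩, h⟩
  · rintro ⟨⟨a, b⟩, ⟨c, d⟩, h⟩; exact ⟨⟨⟨a, b⟩, c, d⟩, h⟩

theorem isCoprime_add_one_of_mod {k x : ℕ} (hx : x % 2 = k) : IsCoprime ((k : ℤ) + 1) (x : ℤ) := by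
  have hk : k = 0 ∨ k = 1 := by omega
  rcases hk with rfl | rfl
  · simpa using isCoprime_one_left
  · have : Nat.Coprime 2 x := by
      rw [Nat.coprime_two_left]; exact Nat.odd_iff.2 hx
    have := Nat.isCoprime_iff_coprime.2 this
    simpa using this

theorem isCoprime_num_den (r : ℚ) : IsCoprime r.num (r.den : ℤ) := by
  rw [Int.isCoprime_iff_gcd_eq_one]
  exact r.reduced

/-- Two admissible heights differ by a multiple of `2 x`, and the window has length `2 x`. -/
theorem IsGapPoint.unique_right {k Q : ℕ} {r : ℚ} {p p' : ℕ × ℕ} (h : IsGapPoint k r p)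
    (h' : IsGapPoint k r p') (hp : p ∈ gapPoints k Q) (hp' : p' ∈ gapPoints k Q) : p = p' := by
  obtain ⟨x, y⟩ := p
  obtain ⟨x', y'⟩ := p'
  rw [mem_gapPoints] at hp hp'
  obtain ⟨hx, A, hA⟩ := h
  obtain ⟨hx', A', hA'⟩ := h'
  simp only at hx hx' hA hA' hp hp'
  obtain rfl : x = x' := by omega
  have hc : IsCoprime (x : ℤ) ((k + 1) * r.num) := by
    refine (IsCoprime.mul_left (isCoprime_add_one_of_mod hp.2.2.1) ?_).symm
    rw [← hx]; exact isCoprime_num_den r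
  have hdvd : (x : ℤ) ∣ (y : ℤ) - y' := by
    refine hc.dvd_of_dvd_mul_left ⟨A - A', ?_⟩
    linear_combination hA' - hA
  have : (y : ℤ) - y' = 0 := by
    apply Int.eq_zero_of_abs_lt_dvd hdvd
    rw [abs_lt]
    omega
  have : y = y' := by omega
  rw [this]

theorem IsGapPoint.unique_left {k Q : ℕ} {r r' : ℚ} {p : ℕ × ℕ} (h : IsGapPoint k r p)
    (h' : IsGapPoint k r' p) (hp : p ∈ gapPoints k Q) (hr : r ∈ parityFarey k Q)
    (hr' : r' ∈ parityFarey k Q) : r = r' := by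
  obtain ⟨x, y⟩ := p
  rw [mem_gapPoints] at hp
  rw [mem_parityFarey] at hr hr'
  obtain ⟨hx, A, hA⟩ := h
  obtain ⟨hx', A', hA'⟩ := h'
  simp only at hx hx' hA hA' hp
  have hc : IsCoprime (x : ℤ) ((k + 1) * y) :=
    (IsCoprime.mul_left (isCoprime_add_one_of_mod hp.2.2.1)
      (Nat.isCoprime_iff_coprime.2 hp.2.2.2.1).symm).symm
  have hdvd : (x : ℤ) ∣ r.num - r'.num := by
    refine hc.dvd_of_dvd_mul_left ⟨A - A', ?_⟩
    linear_combination hA' - hA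
  have num_le : ∀ s : ℚ, s ≤ 1 → s.num ≤ s.den := by
    intro s hs
    have := Rat.le_iff s 1
    simp at this
    exact this.1 hs
  have h1 := num_le r hr.2.1
  have h2 := num_le r' hr'.2.1
  have h3 := Rat.num_pos.2 hr.1
  have h4 := Rat.num_pos.2 hr'.1
  have : r.num - r'.num = 0 := by
    apply Int.eq_zero_of_abs_lt_dvd hdvd
    rw [abs_lt]
    omega
  exact Rat.ext (by omega) (by omega)

theorem exists_gapPoint {k Q : ℕ} {r : ℚ} (hr : r ∈ parityFarey k Q) :
    ∃ p ∈ gapPoints k Q, IsGapPoint k r p := by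
  rw [mem_parityFarey] at hr
  obtain ⟨-, -, hQ, hk⟩ := hr
  have hx0 : (0 : ℤ) < r.den := by exact_mod_cast r.den_pos
  have hc : IsCoprime ((k + 1) * r.num) (r.den : ℤ) :=
    (isCoprime_add_one_of_mod hk).mul_left (isCoprime_num_den r)
  obtain ⟨s, t, hst⟩ := hc
  -- the representative of the class of `-s` in the window `((Q - x) / 2, (Q + x) / 2]`
  obtain ⟨n, hn⟩ : ∃ n : ℤ, n = ((Q : ℤ) - r.den) / 2 + 1 := ⟨_, rfl⟩
  obtain ⟨y, hy⟩ : ∃ y : ℤ, y = n + (-s - n) % r.den := ⟨_, rfl⟩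
  have hm0 := Int.emod_nonneg (-s - n) hx0.ne'
  have hm1 := Int.emod_lt_of_pos (-s - n) hx0
  have hyd : y = -s - r.den * ((-s - n) / r.den) := by
    have := Int.emod_add_mul_ediv (-s - n) r.den
    rw [hy]; linarith
  have hbez : (t - (k + 1) * r.num * ((-s - n) / r.den)) * r.den - (k + 1) * r.num * y = 1 := by
    rw [hyd]; linear_combination hst
  have hy0 : 0 < y := by omega
  refine ⟨(r.den, y.toNat), ?_, rfl, t - (k + 1) * r.num * ((-s - n) / r.den), ?_⟩
  · rw [mem_gapPoints]
    refine ⟨⟨r.den_pos, hQ⟩, by simp only; omega, hk, ?_, by simp only; omega, by simp only; omega⟩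
    simp only
    rw [← Nat.isCoprime_iff_coprime, Int.toNat_of_nonneg hy0.le]
    exact ⟨t - (k + 1) * r.num * ((-s - n) / r.den), -((k + 1) * r.num), by linarith⟩
  · simp only
    rw [Int.toNat_of_nonneg hy0.le]
    exact hbez

theorem rat_den_div_of_isCoprime {a b : ℤ} (hb : 0 < b) (h : IsCoprime a b) :
    ((a : ℚ) / b).num = a ∧ (((a : ℚ) / b).den : ℤ) = b := by
  have h' : a.natAbs.Coprime b.natAbs := by
    rw [Int.isCoprime_iff_gcd_eq_one] at h
    exact h
  exact ⟨Rat.num_div_eq_of_coprime hb h', Rat.den_div_eq_of_coprime hb h'⟩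

theorem exists_left_end {k Q : ℕ} {p : ℕ × ℕ} (hp : p ∈ gapPoints k Q) :
    ∃ r ∈ parityFarey k Q, IsGapPoint k r p := by
  obtain ⟨x, y⟩ := p
  rw [mem_gapPoints] at hp
  obtain ⟨⟨hx0, hxQ⟩, -, hk, hxy, -, -⟩ := hp
  simp only at hx0 hxQ hk hxy
  have hx0' : (0 : ℤ) < x := by exact_mod_cast hx0
  have hc : IsCoprime ((k + 1) * (y : ℤ)) (x : ℤ) :=
    (isCoprime_add_one_of_mod hk).mul_left (Nat.isCoprime_iff_coprime.2 hxy).symm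
  obtain ⟨s, t, hst⟩ := hc
  -- the representative of the class of `-s` in `[1, x]`
  obtain ⟨a, ha⟩ : ∃ a : ℤ, a = 1 + (-s - 1) % x := ⟨_, rfl⟩
  have hm0 := Int.emod_nonneg (-s - 1) hx0'.ne'
  have hm1 := Int.emod_lt_of_pos (-s - 1) hx0'
  have had : a = -s - x * ((-s - 1) / x) := by
    have := Int.emod_add_mul_ediv (-s - 1) x
    rw [ha]; linarith
  have hbez : (t - (k + 1) * y * ((-s - 1) / x)) * x - (k + 1) * a * y = 1 := by
    rw [had]; linear_combination hst
  have hcop : IsCoprime a (x : ℤ) :=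
    ⟨-((k + 1) * y), t - (k + 1) * y * ((-s - 1) / x), by linear_combination hbez⟩
  obtain ⟨hnum, hden⟩ := rat_den_div_of_isCoprime hx0' hcop
  have hden' : ((a : ℚ) / (x : ℤ)).den = x := by exact_mod_cast hden
  have hxq : (0 : ℚ) < (x : ℤ) := by exact_mod_cast hx0'
  refine ⟨(a : ℚ) / (x : ℤ), ?_, hden', t - (k + 1) * y * ((-s - 1) / x), ?_⟩
  · rw [mem_parityFarey, hden']
    refine ⟨div_pos ?_ hxq, ?_, hxQ, hk⟩
    · exact_mod_cast (by omega : 0 < a)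
    · rw [div_le_one hxq]; exact_mod_cast (by omega : a ≤ (x : ℤ))
  · rw [hnum]; exact hbez

theorem nextDen_spec {k Q : ℕ} {p : ℕ × ℕ} (hp : p ∈ gapPoints k Q) :
    0 < nextDen Q p ∧ nextDen Q p ≤ Q ∧ Q < nextDen Q p + 2 * p.2 ∧
      (nextDen Q p : ℤ) = 2 * ((Q + p.1) / (2 * p.2) : ℕ) * p.2 - p.1 := by
  obtain ⟨x, y⟩ := p
  rw [mem_gapPoints] at hp
  obtain ⟨⟨hx0, hxQ⟩, ⟨hy0, -⟩, -, -, h1, h2⟩ := hp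
  simp only [nextDen] at *
  obtain ⟨m, hm⟩ : ∃ m, m = (Q + x) / (2 * y) := ⟨_, rfl⟩
  rw [← hm]
  have e1 : m * (2 * y) ≤ Q + x := by rw [hm]; exact Nat.div_mul_le_self _ _
  have e2 : Q + x < (m + 1) * (2 * y) := by
    rw [hm]; exact (Nat.div_lt_iff_lt_mul (by omega)).1 (Nat.lt_succ_self _)
  have e3 : 1 ≤ m := by rw [hm]; exact (Nat.one_le_div_iff (by omega)).2 h2
  have e4 : m * (2 * y) = 2 * m * y := by ring
  have e5 : (m + 1) * (2 * y) = 2 * m * y + 2 * y := by ring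
  have e6 : y ≤ m * y := Nat.le_mul_of_pos_left _ e3
  have e7 : 2 * m * y = 2 * (m * y) := by ring
  have e8 : ((2 * m * y : ℕ) : ℤ) = 2 * (m : ℤ) * y := by push_cast; ring
  rw [← e8]
  omega

/-- The fraction that follows `r`; it may lie beyond `1`, in which case `r` is the largest element of
`parityFarey k Q`. -/
theorem exists_next {k Q : ℕ} {p : ℕ × ℕ} {r : ℚ} (hp : p ∈ gapPoints k Q)
    (hrp : IsGapPoint k r p) :
    ∃ s : ℚ, s.den = nextDen Q p ∧ s.den ≤ Q ∧ s.den % 2 = k ∧ r < s ∧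
      ∀ z ∈ parityFarey k Q, ¬ (r < z ∧ z < s) := by
  obtain ⟨h0, hQ, hlt, heq⟩ := nextDen_spec hp
  obtain ⟨x, y⟩ := p
  rw [mem_gapPoints] at hp
  obtain ⟨⟨hx0, hxQ⟩, ⟨hy0, -⟩, hk, -, h1, h2⟩ := hp
  obtain ⟨hrx, A, hA⟩ := hrp
  simp only at hx0 hxQ hy0 hk h1 h2 hrx hA heq hlt
  have hk01 : (k : ℤ) = 0 ∨ (k : ℤ) = 1 := by omega
  obtain ⟨m, hm⟩ : ∃ m : ℤ, m = ((Q + x) / (2 * y) : ℕ) := ⟨_, rfl⟩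
  rw [← hm] at heq
  have hm0 : 0 < m := by
    have : 1 ≤ (Q + x) / (2 * y) := (Nat.one_le_div_iff (by omega)).2 h2
    omega
  obtain ⟨D, hD⟩ : ∃ D, D = nextDen Q (x, y) := ⟨_, rfl⟩
  rw [← hD] at heq h0 hQ hlt ⊢
  have hD0 : (0 : ℤ) < D := by exact_mod_cast h0
  have hcop : IsCoprime (m * (2 - k) * A - r.num) (D : ℤ) := by
    refine ⟨(k + 1) * y, -A, ?_⟩
    rw [heq]
    rcases hk01 with h | h <;> rw [h] at hA ⊢ <;> linear_combination hA
  obtain ⟨hnum, hden⟩ := rat_den_div_of_isCoprime hD0 hcop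
  have hden' : (((m * (2 - k) * A - r.num : ℤ) : ℚ) / (D : ℤ)).den = D := by exact_mod_cast hden
  refine ⟨((m * (2 - k) * A - r.num : ℤ) : ℚ) / (D : ℤ), hden', hden'.trans_le hQ, ?_, ?_, ?_⟩
  · rw [hden']
    have : (D : ℤ) = 2 * (m * y) - x := by rw [heq]; ring
    omega
  · rw [Rat.lt_iff, hnum, hden, hrx, heq]
    have : (m * (2 - k) * A - r.num) * x - r.num * (2 * m * y - x) = m * (2 - k) := by
      rcases hk01 with h | h <;> rw [h] at hA ⊢ <;> linear_combination (norm := ring_nf) (2 - (k : ℤ)) * m * hA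
      all_goals rw [h]; ring
    rcases hk01 with h | h <;> rw [h] at this ⊢ <;> linarith
  · rintro z hz ⟨hz1, hz2⟩
    rw [mem_parityFarey] at hz
    rw [Rat.lt_iff] at hz1 hz2
    rw [hnum, hden, heq] at hz2
    rw [hrx] at hz1
    refine no_fraction_between (k := k) (Q := Q) (x := x) (y := y) (a := r.num) (A := A) (m := m)
      (c := z.num) (d := z.den) hk01 (by omega) hA (by omega) (by omega) (by omega) ?_ ?_
      (by exact_mod_cast hz.2.2.1) (by omega) (isCoprime_num_den z) hz1 hz2
    · have : 2 * (m + 1) * (y : ℤ) - x = D + 2 * y := by rw [heq]; ring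
      omega
    · omega

open Classical in
/-- Up to one exception, the gaps of `parityFarey k Q` with denominators subject to a condition
correspond to lattice points. The exception is the lattice point of the largest fraction, whose
right neighbour lies beyond `1`. -/
theorem card_consecutivePairs_bounds (k Q : ℕ) (P : ℕ → ℕ → Prop) :
    ((consecutivePairs (parityFarey k Q)).filter (fun p => P p.1.den p.2.den)).card ≤
      ((gapPoints k Q).filter (fun p => P p.1 (nextDen Q p))).card ∧
    ((gapPoints k Q).filter (fun p => P p.1 (nextDen Q p))).card ≤
      ((consecutivePairs (parityFarey k Q)).filter (fun p => P p.1.den p.2.den)).card + 1 := by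
  have hmem : ∀ q : ℚ × ℚ, q ∈ consecutivePairs (parityFarey k Q) ↔
      (q.1 ∈ parityFarey k Q ∧ q.2 ∈ parityFarey k Q) ∧ q.1 < q.2 ∧
        ∀ z ∈ parityFarey k Q, ¬ (q.1 < z ∧ z < q.2) := by
    intro q; simp [consecutivePairs]
  have key : ∀ p, ∃ rs : ℚ × ℚ, p ∈ gapPoints k Q → rs.1 ∈ parityFarey k Q ∧ IsGapPoint k rs.1 p ∧
      rs.2.den = nextDen Q p ∧ rs.2.den ≤ Q ∧ rs.2.den % 2 = k ∧ rs.1 < rs.2 ∧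
      ∀ z ∈ parityFarey k Q, ¬ (rs.1 < z ∧ z < rs.2) := by
    intro p
    by_cases hp : p ∈ gapPoints k Q
    · obtain ⟨r, hr, hrp⟩ := exists_left_end hp
      obtain ⟨s, hs⟩ := exists_next hp hrp
      exact ⟨(r, s), fun _ => ⟨hr, hrp, hs⟩⟩
    · exact ⟨(0, 0), fun h => absurd h hp⟩
  choose rs hrs using key
  have hinj : ∀ p ∈ gapPoints k Q, ∀ p' ∈ gapPoints k Q, (rs p).1 = (rs p').1 → p = p' := by
    intro p hp p' hp' h
    have h1 := (hrs p hp).2.1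
    rw [h] at h1
    exact h1.unique_right (hrs p' hp').2.1 hp hp'
  constructor
  · have : ∀ q : ℚ × ℚ, ∃ p, q ∈ consecutivePairs (parityFarey k Q) →
        p ∈ gapPoints k Q ∧ rs p = q := by
      intro q
      by_cases hq : q ∈ consecutivePairs (parityFarey k Q)
      · obtain ⟨⟨h1, h2⟩, hlt, hno⟩ := (hmem q).1 hq
        obtain ⟨p, hp, hqp⟩ := exists_gapPoint h1
        obtain ⟨g1, g2, -, g4, g5, g6, g7⟩ := hrs p hp
        have e1 : (rs p).1 = q.1 := g2.unique_left hqp hp g1 h1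
        refine ⟨p, fun _ => ⟨hp, Prod.ext e1 ?_⟩⟩
        rcases lt_trichotomy (rs p).2 q.2 with h | h | h
        · have hs : (rs p).2 ∈ parityFarey k Q := by
            rw [mem_parityFarey] at g1 h2 ⊢
            exact ⟨g1.1.trans g6, h.le.trans h2.2.1, g4, g5⟩
          exact absurd ⟨e1 ▸ g6, h⟩ (hno _ hs)
        · exact h
        · refine absurd ⟨?_, h⟩ (g7 q.2 h2)
          rw [e1]; exact hlt
      · exact ⟨(0, 0), fun h => absurd h hq⟩
    choose f hf using this
    refine Finset.card_le_card_of_injOn f ?_ ?_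
    · intro q hq
      rw [Finset.mem_coe, Finset.mem_filter] at hq ⊢
      obtain ⟨h1, h2⟩ := hf q hq.1
      refine ⟨h1, ?_⟩
      rw [← (hrs _ h1).2.2.1, ← (hrs _ h1).2.1.1, h2]
      exact hq.2
    · intro q hq q' hq' h
      rw [Finset.mem_coe, Finset.mem_filter] at hq hq'
      rw [← (hf q hq.1).2, ← (hf q' hq'.1).2, h]
  · rw [← Finset.card_filter_add_card_filter_not (fun p => (rs p).2 ≤ 1)]
    refine add_le_add ?_ ?_
    · refine Finset.card_le_card_of_injOn rs ?_ ?_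
      · intro p hp
        simp only [Finset.mem_coe, Finset.mem_filter] at hp ⊢
        obtain ⟨⟨hp, hP⟩, h1⟩ := hp
        obtain ⟨g1, g2, g3, g4, g5, g6, g7⟩ := hrs p hp
        refine ⟨(hmem _).2 ⟨⟨g1, ?_⟩, g6, g7⟩, ?_⟩
        · rw [mem_parityFarey] at g1 ⊢
          exact ⟨g1.1.trans g6, h1, g4, g5⟩
        · rw [g2.1, g3]; exact hP
      · intro p hp p' hp' h
        simp only [Finset.coe_filter, Set.mem_ofPred_eq, Finset.mem_filter] at hp hp'
        exact hinj p hp.1.1 p' hp'.1.1 (by rw [h])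
    · rw [Finset.card_le_one]
      intro p hp p' hp'
      simp only [Finset.mem_filter, not_le] at hp hp'
      refine hinj p hp.1.1 p' hp'.1.1 ?_
      obtain ⟨g1, -, -, -, -, g6, g7⟩ := hrs p hp.1.1
      obtain ⟨g1', -, -, -, -, g6', g7'⟩ := hrs p' hp'.1.1
      rcases lt_trichotomy (rs p).1 (rs p').1 with h | h | h
      · exact absurd ⟨h, ((mem_parityFarey.1 g1').2.1).trans_lt hp.2⟩ (g7 _ g1')
      · exact h
      · exact absurd ⟨h, ((mem_parityFarey.1 g1).2.1).trans_lt hp'.2⟩ (g7' _ g1)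

/-! ### Lattice points in dilates of convex sets -/

open MeasureTheory

/-- Preimages under the linear map with matrix `(α β; γ δ)`. -/
theorem volume_preimage_linear (α β γ δ : ℝ) (h : α * δ - β * γ ≠ 0) {S : Set (ℝ × ℝ)}
    (hS : MeasurableSet S) :
    volume {p : Fin 2 → ℝ | (α * p 0 + β * p 1, γ * p 0 + δ * p 1) ∈ S} =
      ENNReal.ofReal |(α * δ - β * γ)⁻¹| * volume S := by
  have hdet : LinearMap.det (Matrix.toLin' !![α, β; γ, δ]) = α * δ - β * γ := by
    rw [LinearMap.det_toLin', Matrix.det_fin_two_of]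
  have h1 : {p : Fin 2 → ℝ | (α * p 0 + β * p 1, γ * p 0 + δ * p 1) ∈ S} =
      (Matrix.toLin' !![α, β; γ, δ]) ⁻¹' ((MeasurableEquiv.finTwoArrow (α := ℝ)) ⁻¹' S) := by
    ext p
    simp [MeasurableEquiv.finTwoArrow, dotProduct, Fin.sum_univ_two]
  rw [h1, Measure.addHaar_preimage_linearMap _ (by rw [hdet]; exact h), hdet,
    (volume_preserving_finTwoArrow ℝ).measure_preimage hS.nullMeasurableSet]

theorem volume_preimage_linear_prod (α β γ δ : ℝ) (h : α * δ - β * γ ≠ 0) {S : Set (ℝ × ℝ)}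
    (hS : MeasurableSet S) :
    volume {p : ℝ × ℝ | (α * p.1 + β * p.2, γ * p.1 + δ * p.2) ∈ S} =
      ENNReal.ofReal |(α * δ - β * γ)⁻¹| * volume S := by
  rw [← volume_preimage_linear α β γ δ h hS]
  have hm : Measurable fun p : ℝ × ℝ => (α * p.1 + β * p.2, γ * p.1 + δ * p.2) := by fun_prop
  exact ((volume_preserving_finTwoArrow ℝ).measure_preimage (hm hS).nullMeasurableSet).symm

open Classical in
/-- The points of `[1, Q]²` in the dilate `Q Ω` whose coordinates are divisible by `a` and `b`. -/
noncomputable def latticeCount (Ω : Set (ℝ × ℝ)) (a b Q : ℕ) : ℕ :=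
  ((Finset.Icc 1 Q ×ˢ Finset.Icc 1 Q).filter (fun p : ℕ × ℕ =>
    a ∣ p.1 ∧ b ∣ p.2 ∧ ((p.1 : ℝ) / Q, (p.2 : ℝ) / Q) ∈ Ω)).card

theorem mem_Icc_of_mem_region {Ω : Set (ℝ × ℝ)} (hΩ : Ω ⊆ Set.Ioc 0 1 ×ˢ Set.Ioc 0 1) {Q : ℕ}
    (hQ : 0 < Q) {x y : ℕ} (h : ((x : ℝ) / Q, (y : ℝ) / Q) ∈ Ω) :
    (1 ≤ x ∧ x ≤ Q) ∧ 1 ≤ y ∧ y ≤ Q := by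
  have hQ' : (0 : ℝ) < Q := by exact_mod_cast hQ
  obtain ⟨⟨h1, h2⟩, h3, h4⟩ := hΩ h
  simp only at h1 h2 h3 h4
  rw [div_le_one hQ'] at h2 h4
  rw [lt_div_iff₀ hQ', zero_mul] at h1 h3
  exact ⟨⟨by exact_mod_cast h1, by exact_mod_cast h2⟩, by exact_mod_cast h3, by exact_mod_cast h4⟩

theorem tendsto_latticeCount {Ω : Set (ℝ × ℝ)} (hΩ : Ω ⊆ Set.Ioc 0 1 ×ˢ Set.Ioc 0 1)
    (hc : Convex ℝ Ω) (hm : MeasurableSet Ω) {a b : ℕ} (ha : 0 < a) (hb : 0 < b) :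
    Tendsto (fun Q : ℕ => (latticeCount Ω a b Q : ℝ) / (Q : ℝ) ^ 2) atTop
      (𝓝 (volume.real Ω / (a * b))) := by
  have ha' : (0 : ℝ) < a := by exact_mod_cast ha
  have hb' : (0 : ℝ) < b := by exact_mod_cast hb
  obtain ⟨s, hs⟩ : ∃ s : Set (Fin 2 → ℝ), s = {p | ((a : ℝ) * p 0 + 0 * p 1, 0 * p 0 + (b : ℝ) * p 1) ∈ Ω} :=
    ⟨_, rfl⟩
  have hmem : ∀ p, p ∈ s ↔ ((a : ℝ) * p 0, (b : ℝ) * p 1) ∈ Ω := by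
    intro p; rw [hs]; simp
  have hsvol : volume.real s = volume.real Ω / (a * b) := by
    rw [measureReal_def, hs, volume_preimage_linear _ _ _ _ (by simp [ha.ne', hb.ne']) hm,
      ENNReal.toReal_mul, ENNReal.toReal_ofReal (abs_nonneg _), measureReal_def]
    rw [abs_of_pos (by simp; positivity)]
    field_simp
    simp
  have hsm : MeasurableSet s := by
    have hf : Measurable fun p : Fin 2 → ℝ =>
      ((a : ℝ) * p 0 + 0 * p 1, 0 * p 0 + (b : ℝ) * p 1) := by fun_prop
    rw [hs]
    exact hf hm
  have hsb : Bornology.IsBounded s := by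
    refine (Metric.isBounded_Icc (0 : Fin 2 → ℝ) (fun _ => 1)).subset fun p hp => ?_
    obtain ⟨⟨h1, h2⟩, h3, h4⟩ := hΩ ((hmem p).1 hp)
    simp only at h1 h2 h3 h4
    have ha1 : (1 : ℝ) ≤ a := by exact_mod_cast ha
    have hb1 : (1 : ℝ) ≤ b := by exact_mod_cast hb
    have q0 := pos_of_mul_pos_right h1 ha'.le
    have q1 := pos_of_mul_pos_right h3 hb'.le
    rw [Set.mem_Icc, Pi.le_def, Pi.le_def]
    simp only [Fin.forall_fin_two, Pi.zero_apply]
    exact ⟨⟨q0.le, q1.le⟩, by nlinarith, by nlinarith⟩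
  have hsc : Convex ℝ s := by
    intro p hp q hq α β hα hβ hαβ
    rw [hmem] at *
    have := hc hp hq hα hβ hαβ
    convert this using 1
    simp only [Pi.add_apply, Pi.smul_apply, smul_eq_mul, Prod.smul_mk, Prod.mk_add_mk]
    ring_nf
  have main := tendsto_card_div_pow_atTop_volume s hsb hsm (hsc.addHaar_frontier volume)
  rw [hsvol] at main
  refine main.congr' ?_
  filter_upwards [eventually_gt_atTop 0] with Q hQ
  have hQ' : (0 : ℝ) < Q := by exact_mod_cast hQ
  congr 2
  rw [latticeCount, Nat.card_coe_set_eq, ← Set.ncard_coe_finset]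
  symm
  refine Set.ncard_congr (fun p _ => ![(p.1 : ℝ) / (a * Q), (p.2 : ℝ) / (b * Q)]) ?_ ?_ ?_
  · rintro ⟨x, y⟩ hp
    simp only [Finset.mem_coe, Finset.mem_filter] at hp
    obtain ⟨-, ⟨i, rfl⟩, ⟨j, rfl⟩, hp⟩ := hp
    refine ⟨?_, ?_⟩
    · rw [hmem]
      convert hp using 2 <;> simp <;> field_simp
    · rw [Set.mem_smul_set]
      refine ⟨![(i : ℝ), (j : ℝ)], ?_, ?_⟩
      · rw [SetLike.mem_coe, Module.Basis.mem_span_iff_repr_mem]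
        intro t
        fin_cases t
        · exact ⟨(i : ℤ), by simp⟩
        · exact ⟨(j : ℤ), by simp⟩
      · ext t
        fin_cases t <;> simp <;> field_simp
  · rintro ⟨x, y⟩ ⟨x', y'⟩ - - h
    have h0 := congrFun h 0
    have h1 := congrFun h 1
    simp only [Matrix.cons_val_zero, Matrix.cons_val_one] at h0 h1
    rw [div_left_inj' (by positivity)] at h0 h1
    norm_cast at h0 h1
    rw [h0, h1]
  · rintro p ⟨hp, hL⟩
    obtain ⟨v, hv, rfl⟩ := Set.mem_smul_set.1 hL
    rw [SetLike.mem_coe, Module.Basis.mem_span_iff_repr_mem] at hv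
    obtain ⟨i, hi⟩ := hv 0
    obtain ⟨j, hj⟩ := hv 1
    simp only [algebraMap_int_eq, Int.coe_castRingHom, Pi.basisFun_repr] at hi hj
    rw [hmem] at hp
    simp only [Pi.smul_apply, smul_eq_mul, ← hi, ← hj] at hp
    obtain ⟨⟨h1, -⟩, h3, -⟩ := hΩ hp
    simp only at h1 h3
    have hi0 : 0 < i := by
      have := pos_of_mul_pos_right (pos_of_mul_pos_right h1 ha'.le) (by positivity)
      exact_mod_cast this
    have hj0 : 0 < j := by
      have := pos_of_mul_pos_right (pos_of_mul_pos_right h3 hb'.le) (by positivity)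
      exact_mod_cast this
    lift i to ℕ using hi0.le
    lift j to ℕ using hj0.le
    have hreg : (((a * i : ℕ) : ℝ) / Q, ((b * j : ℕ) : ℝ) / Q) ∈ Ω := by
      convert hp using 2 <;> push_cast <;> ring
    refine ⟨(a * i, b * j), ?_, ?_⟩
    · simp only [Finset.mem_coe, Finset.mem_filter, Finset.mem_product, Finset.mem_Icc]
      exact ⟨mem_Icc_of_mem_region hΩ hQ hreg, dvd_mul_right _ _, dvd_mul_right _ _, hreg⟩
    · ext t
      fin_cases t
      · simp [← hi]; field_simp
      · simp [← hj]; field_simp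

theorem latticeCount_le (Ω : Set (ℝ × ℝ)) {d Q : ℕ} {a b : ℕ} (hd : 0 < d) (ha : d ∣ a)
    (hb : d ∣ b) : (latticeCount Ω a b Q : ℝ) ≤ (Q : ℝ) ^ 2 / (d : ℝ) ^ 2 := by
  have hd' : (0 : ℝ) < d := by exact_mod_cast hd
  have h1 : latticeCount Ω a b Q ≤ (Q / d) * (Q / d) := by
    have : (Finset.Icc 1 (Q / d) ×ˢ Finset.Icc 1 (Q / d)).card = (Q / d) * (Q / d) := by
      rw [Finset.card_product, Nat.card_Icc]; simp
    rw [← this, latticeCount]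
    refine Finset.card_le_card_of_injOn (fun p => (p.1 / d, p.2 / d)) ?_ ?_
    · rintro ⟨x, y⟩ hp
      simp only [Finset.mem_coe, Finset.mem_filter, Finset.mem_product, Finset.mem_Icc] at hp ⊢
      obtain ⟨⟨⟨h1, h2⟩, h3, h4⟩, h5, h6, -⟩ := hp
      exact ⟨⟨Nat.div_pos (Nat.le_of_dvd h1 (ha.trans h5)) hd, Nat.div_le_div_right h2⟩,
        Nat.div_pos (Nat.le_of_dvd h3 (hb.trans h6)) hd, Nat.div_le_div_right h4⟩
    · rintro ⟨x, y⟩ hp ⟨x', y'⟩ hp' h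
      simp only [Finset.mem_coe, Finset.mem_filter] at hp hp'
      simp only [Prod.mk.injEq] at h ⊢
      exact ⟨(Nat.div_left_inj (ha.trans hp.2.1) (ha.trans hp'.2.1)).1 h.1,
        (Nat.div_left_inj (hb.trans hp.2.2.1) (hb.trans hp'.2.2.1)).1 h.2⟩
  have h2 : ((Q / d : ℕ) : ℝ) ≤ Q / d := Nat.cast_div_le
  calc (latticeCount Ω a b Q : ℝ) ≤ ((Q / d : ℕ) : ℝ) * ((Q / d : ℕ) : ℝ) := by exact_mod_cast h1
    _ ≤ (Q / d : ℝ) * (Q / d : ℝ) := by gcongr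
    _ = _ := by rw [div_mul_div_comm, sq, sq]

/-! ### Visible points in dilates of convex sets -/

theorem sum_divisors_moebius (n : ℕ) :
    ∑ d ∈ n.divisors, (ArithmeticFunction.moebius d : ℝ) = if n = 1 then 1 else 0 := by
  have := congrArg (fun f => (f n : ℤ)) ArithmeticFunction.coe_zeta_mul_moebius
  simp only [ArithmeticFunction.coe_zeta_mul_apply, ArithmeticFunction.one_apply] at this
  exact_mod_cast congrArg (fun z : ℤ => (z : ℝ)) this

/-- `∑ μ(d) / d²` over the odd `d`. -/
noncomputable def oddMoebiusSum : ℝ :=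
  ∑' d : ℕ, if Odd d then (ArithmeticFunction.moebius d : ℝ) / (d : ℝ) ^ 2 else 0

theorem norm_odd_moebius_le (d : ℕ) (t : ℝ) (ht : |t| ≤ 1 / (d : ℝ) ^ 2) :
    ‖if Odd d then (ArithmeticFunction.moebius d : ℝ) * t else 0‖ ≤ 1 / (d : ℝ) ^ 2 := by
  split_ifs
  · have : |(ArithmeticFunction.moebius d : ℝ)| ≤ 1 := by
      exact_mod_cast ArithmeticFunction.abs_moebius_le_one (n := d)
    rw [Real.norm_eq_abs, abs_mul]
    calc _ ≤ 1 * (1 / (d : ℝ) ^ 2) := mul_le_mul this ht (abs_nonneg _) zero_le_one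
      _ = _ := one_mul _
  · rw [norm_zero]; positivity

/-- Only the positivity of this constant matters: it cancels from every proportion. -/
theorem oddMoebiusSum_pos : 0 < oddMoebiusSum := by
  have hs : Summable fun d : ℕ => 1 / (d : ℝ) ^ 2 := Real.summable_one_div_nat_pow.2 (by norm_num)
  have hb : ∀ d : ℕ, ‖if Odd d then (ArithmeticFunction.moebius d : ℝ) / (d : ℝ) ^ 2 else 0‖ ≤
      1 / (d : ℝ) ^ 2 := by
    intro d
    have := norm_odd_moebius_le d (1 / (d : ℝ) ^ 2) (abs_of_nonneg (by positivity)).le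
    simpa only [mul_one_div] using this
  have hsum := Summable.of_norm_bounded hs hb
  have h1 := hsum.sum_add_tsum_nat_add 3
  have h2 := hs.sum_add_tsum_nat_add 3
  rw [hasSum_zeta_two.tsum_eq] at h2
  have h3 : |∑' i : ℕ, (if Odd (i + 3) then
      (ArithmeticFunction.moebius (i + 3) : ℝ) / ((i + 3 : ℕ) : ℝ) ^ 2 else 0)| ≤
      ∑' i : ℕ, 1 / ((i + 3 : ℕ) : ℝ) ^ 2 := by
    rw [← Real.norm_eq_abs]
    exact tsum_of_norm_bounded ((summable_nat_add_iff 3).2 hs).hasSum (fun i => hb (i + 3))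
  rw [oddMoebiusSum, ← h1]
  simp [Finset.sum_range_succ] at h2 ⊢
  have h4 : Real.pi ^ 2 < 10 := by nlinarith [Real.pi_lt_d2, Real.pi_pos]
  have h5 := neg_le_of_abs_le h3
  simp at h5
  norm_num at h2 h5 ⊢
  linarith

open Classical in
/-- The visible points in the dilate `Q Ω` that lie in `aℤ × bℤ` and not in `a'ℤ × b'ℤ`. -/
noncomputable def visibleCount (Ω : Set (ℝ × ℝ)) (a b a' b' Q : ℕ) : ℕ :=
  ((Finset.Icc 1 Q ×ˢ Finset.Icc 1 Q).filter (fun p : ℕ × ℕ =>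
    ((a ∣ p.1 ∧ b ∣ p.2) ∧ ¬ (a' ∣ p.1 ∧ b' ∣ p.2)) ∧ ((p.1 : ℝ) / Q, (p.2 : ℝ) / Q) ∈ Ω ∧
      p.1.Coprime p.2)).card

theorem mul_dvd_iff_of_odd {a d x : ℕ} (ha : a = 1 ∨ a = 2) (hd : Odd d) :
    a * d ∣ x ↔ a ∣ x ∧ d ∣ x := by
  have : a.Coprime d := by
    rcases ha with rfl | rfl
    · exact Nat.coprime_one_left d
    · exact Nat.coprime_two_left.2 hd
  exact ⟨fun h => ⟨(dvd_mul_right _ _).trans h, (dvd_mul_left _ _).trans h⟩,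
    fun h => this.mul_dvd_of_dvd_of_dvd h.1 h.2⟩

/-- Möbius inversion over the odd common divisors. -/
theorem visibleCount_eq_tsum (Ω : Set (ℝ × ℝ)) {a b a' b' : ℕ} (ha : a = 1 ∨ a = 2)
    (hb : b = 1 ∨ b = 2) (ha' : a' = 1 ∨ a' = 2) (hb' : b' = 1 ∨ b' = 2) (haa : a ∣ a')
    (hbb : b ∣ b') (hodd : ∀ x y, a ∣ x → b ∣ y → ¬ (a' ∣ x ∧ b' ∣ y) → Odd (Nat.gcd x y)) (Q : ℕ) :
    (visibleCount Ω a b a' b' Q : ℝ) =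
      ∑' d : ℕ, if Odd d then (ArithmeticFunction.moebius d : ℝ) *
        ((latticeCount Ω (a * d) (b * d) Q : ℝ) - latticeCount Ω (a' * d) (b' * d) Q) else 0 := by
  classical
  obtain ⟨G, hG⟩ : ∃ G, G = (Finset.Icc 1 Q ×ˢ Finset.Icc 1 Q).filter (fun p : ℕ × ℕ =>
    ((a ∣ p.1 ∧ b ∣ p.2) ∧ ¬ (a' ∣ p.1 ∧ b' ∣ p.2)) ∧ ((p.1 : ℝ) / Q, (p.2 : ℝ) / Q) ∈ Ω) :=
    ⟨_, rfl⟩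
  have hcount : ∀ d, Odd d → ((G.filter (fun p => d ∣ p.1 ∧ d ∣ p.2)).card : ℝ) =
      (latticeCount Ω (a * d) (b * d) Q : ℝ) - latticeCount Ω (a' * d) (b' * d) Q := by
    intro d hd
    rw [eq_sub_iff_add_eq]
    norm_cast
    rw [latticeCount, latticeCount, hG, Finset.filter_filter]
    rw [← Finset.card_union_of_disjoint]
    · congr 1
      ext p
      simp only [Finset.mem_union, Finset.mem_filter, mul_dvd_iff_of_odd ha hd,
        mul_dvd_iff_of_odd hb hd, mul_dvd_iff_of_odd ha' hd, mul_dvd_iff_of_odd hb' hd]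
      have i1 : a' ∣ p.1 → a ∣ p.1 := haa.trans
      have i2 : b' ∣ p.2 → b ∣ p.2 := hbb.trans
      constructor
      · rintro (⟨h1, ⟨⟨h2, -⟩, h4⟩, h3⟩ | ⟨h1, h2, h3, h4⟩)
        · exact ⟨h1, ⟨h2.1, h3.1⟩, ⟨h2.2, h3.2⟩, h4⟩
        · exact ⟨h1, ⟨i1 h2.1, h2.2⟩, ⟨i2 h3.1, h3.2⟩, h4⟩
      · rintro ⟨h1, h2, h3, h4⟩
        by_cases h : a' ∣ p.1 ∧ b' ∣ p.2
        · exact Or.inr ⟨h1, ⟨h.1, h2.2⟩, ⟨h.2, h3.2⟩, h4⟩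
        · exact Or.inl ⟨h1, ⟨⟨⟨h2.1, h3.1⟩, h⟩, h4⟩, h2.2, h3.2⟩
    · rw [Finset.disjoint_left]
      intro p hp hp'
      simp only [Finset.mem_filter, mul_dvd_iff_of_odd ha' hd, mul_dvd_iff_of_odd hb' hd] at hp hp'
      exact hp.2.1.1.2 ⟨hp'.2.1.1, hp'.2.2.1.1⟩
  have hsupp : ∀ d ∉ (Finset.Icc 1 Q), (if Odd d then (ArithmeticFunction.moebius d : ℝ) *
        ((latticeCount Ω (a * d) (b * d) Q : ℝ) - latticeCount Ω (a' * d) (b' * d) Q) else 0) = 0 := by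
    intro d hd
    split_ifs with ho
    · rw [← hcount d ho, Finset.card_eq_zero.2, Nat.cast_zero, mul_zero]
      rw [Finset.filter_eq_empty_iff]
      rintro p hp ⟨h1, -⟩
      rw [hG] at hp
      simp only [Finset.mem_filter, Finset.mem_product, Finset.mem_Icc] at hp hd
      have := Nat.le_of_dvd (by omega) h1
      have := ho.pos
      omega
    · rfl
  rw [tsum_eq_sum hsupp]
  have hsum : ∀ p ∈ G, (if p.1.Coprime p.2 then (1 : ℝ) else 0) =
      ∑ d ∈ Finset.Icc 1 Q, if Odd d then (ArithmeticFunction.moebius d : ℝ) *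
        (if d ∣ p.1 ∧ d ∣ p.2 then 1 else 0) else 0 := by
    intro p hp
    rw [hG] at hp
    simp only [Finset.mem_filter, Finset.mem_product, Finset.mem_Icc] at hp
    have ho := hodd p.1 p.2 hp.2.1.1.1 hp.2.1.1.2 hp.2.1.2
    have hg : 0 < Nat.gcd p.1 p.2 := ho.pos
    have hone : (if p.1.Coprime p.2 then (1 : ℝ) else 0) =
        if Nat.gcd p.1 p.2 = 1 then 1 else 0 := by simp only [Nat.coprime_iff_gcd_eq_one]
    rw [hone, ← sum_divisors_moebius]
    have hsub : (Nat.gcd p.1 p.2).divisors ⊆ Finset.Icc 1 Q := by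
      intro d hd
      rw [Nat.mem_divisors] at hd
      rw [Finset.mem_Icc]
      have h1 := Nat.le_of_dvd (by omega) (hd.1.trans (Nat.gcd_dvd_left p.1 p.2))
      have h2 := Nat.pos_of_dvd_of_pos hd.1 hg
      omega
    rw [← Finset.sum_subset hsub]
    · refine Finset.sum_congr rfl fun d hd => ?_
      rw [Nat.mem_divisors] at hd
      rw [if_pos (ho.of_dvd_nat hd.1), if_pos (Nat.dvd_gcd_iff.1 hd.1), mul_one]
    · intro d _ hd
      rw [Nat.mem_divisors, not_and_or, Nat.dvd_gcd_iff] at hd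
      rw [if_neg (hd.resolve_right (by omega))]
      simp
  have hcard : (visibleCount Ω a b a' b' Q : ℝ) = ∑ p ∈ G, if p.1.Coprime p.2 then (1 : ℝ) else 0 := by
    rw [Finset.sum_boole, hG, Finset.filter_filter, visibleCount]
    simp only [and_assoc]
  rw [hcard, Finset.sum_congr rfl hsum, Finset.sum_comm]
  refine Finset.sum_congr rfl fun d _ => ?_
  split_ifs with ho
  · rw [← hcount d ho, ← Finset.mul_sum, Finset.sum_boole]
  · simp

/-- The inversion formula passes to the limit term by term, since the term of `d` is at most
`Q² / d²`. -/
theorem tendsto_visibleCount {Ω : Set (ℝ × ℝ)} (hΩ : Ω ⊆ Set.Ioc 0 1 ×ˢ Set.Ioc 0 1)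
    (hc : Convex ℝ Ω) (hm : MeasurableSet Ω) {a b a' b' : ℕ} (ha : a = 1 ∨ a = 2)
    (hb : b = 1 ∨ b = 2) (ha' : a' = 1 ∨ a' = 2) (hb' : b' = 1 ∨ b' = 2) (haa : a ∣ a')
    (hbb : b ∣ b') (hodd : ∀ x y, a ∣ x → b ∣ y → ¬ (a' ∣ x ∧ b' ∣ y) → Odd (Nat.gcd x y)) :
    Tendsto (fun Q : ℕ => (visibleCount Ω a b a' b' Q : ℝ) / (Q : ℝ) ^ 2) atTop
      (𝓝 (oddMoebiusSum * (1 / (a * b) - 1 / (a' * b')) * volume.real Ω)) := by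
  have hs : Summable fun d : ℕ => 1 / (d : ℝ) ^ 2 := Real.summable_one_div_nat_pow.2 (by norm_num)
  have hlim : oddMoebiusSum * (1 / (a * b) - 1 / (a' * b')) * volume.real Ω =
      ∑' d : ℕ, if Odd d then (ArithmeticFunction.moebius d : ℝ) *
        (volume.real Ω / ((a * d : ℕ) * (b * d : ℕ)) - volume.real Ω / ((a' * d : ℕ) * (b' * d : ℕ))) else 0 := by
    rw [oddMoebiusSum, ← tsum_mul_right, ← tsum_mul_right]
    refine tsum_congr fun d => ?_
    split_ifs with ho
    · have : (d : ℝ) ≠ 0 := by exact_mod_cast ho.pos.ne'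
      have h1 : (a : ℝ) ≠ 0 := by exact_mod_cast (by omega : a ≠ 0)
      have h2 : (b : ℝ) ≠ 0 := by exact_mod_cast (by omega : b ≠ 0)
      have h3 : (a' : ℝ) ≠ 0 := by exact_mod_cast (by omega : a' ≠ 0)
      have h4 : (b' : ℝ) ≠ 0 := by exact_mod_cast (by omega : b' ≠ 0)
      push_cast
      field_simp
    · simp
  rw [hlim]
  have hterm : ∀ Q : ℕ, (visibleCount Ω a b a' b' Q : ℝ) / (Q : ℝ) ^ 2 =
      ∑' d : ℕ, if Odd d then (ArithmeticFunction.moebius d : ℝ) *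
        ((latticeCount Ω (a * d) (b * d) Q : ℝ) / (Q : ℝ) ^ 2 -
          latticeCount Ω (a' * d) (b' * d) Q / (Q : ℝ) ^ 2) else 0 := by
    intro Q
    rw [visibleCount_eq_tsum Ω ha hb ha' hb' haa hbb hodd, ← tsum_div_const]
    refine tsum_congr fun d => ?_
    split_ifs
    · ring
    · simp
  simp_rw [hterm]
  refine tendsto_tsum_of_dominated_convergence hs ?_ ?_
  · intro d
    split_ifs with ho
    · exact ((tendsto_latticeCount hΩ hc hm (Nat.mul_pos (by omega) ho.pos)
        (Nat.mul_pos (by omega) ho.pos)).sub (tendsto_latticeCount hΩ hc hm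
        (Nat.mul_pos (by omega) ho.pos) (Nat.mul_pos (by omega) ho.pos))).const_mul _
    · exact tendsto_const_nhds
  · filter_upwards [eventually_gt_atTop 0] with Q hQ d
    have hQ' : (0 : ℝ) < Q := by exact_mod_cast hQ
    rcases Nat.eq_zero_or_pos d with rfl | hd
    · simp
    refine norm_odd_moebius_le d _ ?_
    have hb1 : ∀ a b : ℕ, (latticeCount Ω (a * d) (b * d) Q : ℝ) / (Q : ℝ) ^ 2 ≤ 1 / (d : ℝ) ^ 2 := by
      intro a b
      rw [div_le_iff₀ (by positivity)]
      refine (latticeCount_le Ω hd (dvd_mul_left d a) (dvd_mul_left d b)).trans_eq ?_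
      ring
    have h1 := hb1 a b
    have h2 := hb1 a' b'
    have h3 : 0 ≤ (latticeCount Ω (a * d) (b * d) Q : ℝ) / (Q : ℝ) ^ 2 := by positivity
    have h4 : 0 ≤ (latticeCount Ω (a' * d) (b' * d) Q : ℝ) / (Q : ℝ) ^ 2 := by positivity
    rw [abs_le]
    constructor <;> linarith

open Classical in
/-- The visible points `(x, y)` in the dilate `Q Ω` with `x` congruent to `k` modulo `2`. -/
noncomputable def parityCount (Ω : Set (ℝ × ℝ)) (k Q : ℕ) : ℕ :=
  ((Finset.Icc 1 Q ×ˢ Finset.Icc 1 Q).filter (fun p : ℕ × ℕ =>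
    p.1 % 2 = k ∧ ((p.1 : ℝ) / Q, (p.2 : ℝ) / Q) ∈ Ω ∧ p.1.Coprime p.2)).card

/-- Visible points with a coordinate of given parity are equidistributed. For `k = 0` they are the
points of `2ℤ × ℤ` outside `2ℤ × 2ℤ`, for `k = 1` the points outside `2ℤ × ℤ`. -/
theorem exists_tendsto_parityCount {k : ℕ} (hk : k = 0 ∨ k = 1) :
    ∃ c : ℝ, 0 < c ∧ ∀ Ω : Set (ℝ × ℝ), Ω ⊆ Set.Ioc 0 1 ×ˢ Set.Ioc 0 1 → Convex ℝ Ω →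
      MeasurableSet Ω → Tendsto (fun Q : ℕ => (parityCount Ω k Q : ℝ) / (Q : ℝ) ^ 2) atTop
        (𝓝 (c * volume.real Ω)) := by
  have hpos := oddMoebiusSum_pos
  rcases hk with rfl | rfl
  · refine ⟨oddMoebiusSum * (1 / ((2 : ℕ) * (1 : ℕ)) - 1 / ((2 : ℕ) * (2 : ℕ))), ?_, ?_⟩
    · refine mul_pos hpos (by norm_num)
    · intro Ω h1 h2 h3
      refine (tendsto_visibleCount h1 h2 h3 (Or.inr rfl) (Or.inl rfl) (Or.inr rfl) (Or.inr rfl)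
        (by norm_num) (by norm_num) ?_).congr fun Q => ?_
      · intro x y hx _ hxy
        have hy : Odd y := by
          rw [← Nat.not_even_iff_odd, even_iff_two_dvd]; tauto
        exact hy.of_dvd_nat (Nat.gcd_dvd_right x y)
      · congr 2
        rw [visibleCount, parityCount]
        congr 1
        ext p
        simp only [Finset.mem_filter, and_congr_right_iff]
        intro _
        rw [← Nat.dvd_iff_mod_eq_zero]
        simp only [one_dvd, and_true]
        constructor
        · tauto
        · rintro ⟨h1, h2, h3⟩
          refine ⟨⟨h1, fun h => ?_⟩, h2, h3⟩
          have := Nat.dvd_gcd h.1 h.2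
          rw [h3] at this
          omega
  · refine ⟨oddMoebiusSum * (1 / ((1 : ℕ) * (1 : ℕ)) - 1 / ((2 : ℕ) * (1 : ℕ))), ?_, ?_⟩
    · refine mul_pos hpos (by norm_num)
    · intro Ω h1 h2 h3
      refine (tendsto_visibleCount h1 h2 h3 (Or.inl rfl) (Or.inl rfl) (Or.inr rfl) (Or.inl rfl)
        (by norm_num) (by norm_num) ?_).congr fun Q => ?_
      · intro x y _ _ hxy
        have hx : Odd x := by
          rw [← Nat.not_even_iff_odd, even_iff_two_dvd]
          simpa using hxy
        exact hx.of_dvd_nat (Nat.gcd_dvd_left x y)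
      · congr 2
        rw [visibleCount, parityCount]
        congr 1
        ext p
        simp only [Finset.mem_filter, and_congr_right_iff]
        intro _
        have : p.1 % 2 = 1 ↔ ¬ 2 ∣ p.1 := by omega
        rw [this]
        simp only [one_dvd, and_true, true_and]

/-! ### The limiting proportion in a square -/

/-- The part of the square of side `2 η` about `(u, v)` that consists of the (scaled) pairs of
denominators of consecutive fractions whose denominators add up to `2 m y`. -/
def indexRegion (m : ℕ) (u v η : ℝ) : Set (ℝ × ℝ) :=
  {p | (p.1 ∈ Set.Ioo (u - η) (u + η) ∧ p.2 ∈ Set.Ioo (v - η) (v + η)) ∧ (p.1 ≤ 1 ∧ p.2 ≤ 1) ∧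
    (m : ℝ) < (m + 1) * p.1 + p.2 ∧ (m : ℝ) < (m + 1) * p.2 + p.1}

/-- `indexRegion` in the coordinates `(x, y)` of the lattice points of `gapPoints`. -/
def gapRegion (m : ℕ) (u v η : ℝ) : Set (ℝ × ℝ) :=
  {p | (1 * p.1 + 0 * p.2, -1 * p.1 + 2 * m * p.2) ∈ indexRegion m u v η}

theorem convex_setOf_lt_linear (a b c : ℝ) : Convex ℝ {p : ℝ × ℝ | c < a * p.1 + b * p.2} := by
  refine convex_halfSpace_gt (f := fun p : ℝ × ℝ => a * p.1 + b * p.2) ⟨?_, ?_⟩ c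
  · intro p q; simp only [Prod.fst_add, Prod.snd_add]; ring
  · intro t p; simp only [Prod.smul_fst, Prod.smul_snd, smul_eq_mul]; ring

theorem convex_setOf_le_linear (a b c : ℝ) : Convex ℝ {p : ℝ × ℝ | a * p.1 + b * p.2 ≤ c} := by
  refine convex_halfSpace_le (f := fun p : ℝ × ℝ => a * p.1 + b * p.2) ⟨?_, ?_⟩ c
  · intro p q; simp only [Prod.fst_add, Prod.snd_add]; ring
  · intro t p; simp only [Prod.smul_fst, Prod.smul_snd, smul_eq_mul]; ring

theorem convex_indexRegion (m : ℕ) (u v η : ℝ) : Convex ℝ (indexRegion m u v η) := by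
  have h1 : Convex ℝ (Set.Ioo (u - η) (u + η) ×ˢ Set.Ioo (v - η) (v + η)) :=
    (convex_Ioo _ _).prod (convex_Ioo _ _)
  have h2 : Convex ℝ (Set.Iic (1 : ℝ) ×ˢ Set.Iic (1 : ℝ)) := (convex_Iic _).prod (convex_Iic _)
  have h3 := convex_setOf_lt_linear ((m : ℝ) + 1) 1 m
  have h4 := convex_setOf_lt_linear 1 ((m : ℝ) + 1) m
  convert h1.inter (h2.inter (h3.inter h4)) using 1
  ext p
  simp only [indexRegion, Set.mem_ofPred_eq, Set.mem_inter_iff, Set.mem_prod, Set.mem_Iic, one_mul]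
  rw [add_comm p.1]

theorem measurableSet_indexRegion (m : ℕ) (u v η : ℝ) : MeasurableSet (indexRegion m u v η) := by
  refine MeasurableSet.inter (MeasurableSet.inter ?_ ?_) (MeasurableSet.inter
    (MeasurableSet.inter ?_ ?_) (MeasurableSet.inter ?_ ?_))
  · exact measurable_fst measurableSet_Ioo
  · exact measurable_snd measurableSet_Ioo
  · exact measurableSet_le measurable_fst measurable_const
  · exact measurableSet_le measurable_snd measurable_const
  · exact measurableSet_lt (f := fun _ => (m : ℝ)) measurable_const
      (g := fun p : ℝ × ℝ => (m + 1) * p.1 + p.2) (by fun_prop)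
  · exact measurableSet_lt (f := fun _ => (m : ℝ)) measurable_const
      (g := fun p : ℝ × ℝ => (m + 1) * p.2 + p.1) (by fun_prop)

theorem mem_gapRegion {m : ℕ} (hm : 0 < m) {u v η x y : ℝ} :
    (x, y) ∈ gapRegion m u v η ↔
      (x ∈ Set.Ioo (u - η) (u + η) ∧ 2 * m * y - x ∈ Set.Ioo (v - η) (v + η)) ∧
      (x ≤ 1 ∧ 2 * m * y ≤ 1 + x) ∧ 1 < x + 2 * y ∧ 1 + x < 2 * (m + 1) * y := by
  have hm' : (0 : ℝ) < m := by exact_mod_cast hm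
  have e1 : (1 : ℝ) * x + 0 * y = x := by ring
  have e2 : (-1 : ℝ) * x + 2 * m * y = 2 * m * y - x := by ring
  simp only [gapRegion, indexRegion, Set.mem_ofPred_eq, e1, e2]
  have a1 : 2 * m * y - x ≤ 1 ↔ 2 * m * y ≤ 1 + x := by constructor <;> intro h <;> linarith
  have a2 : (m : ℝ) < (m + 1) * x + (2 * m * y - x) ↔ 1 < x + 2 * y := by
    rw [show (m + 1) * x + (2 * m * y - x) = m * (x + 2 * y) by ring]
    exact lt_mul_iff_one_lt_right hm'
  have a3 : (m : ℝ) < (m + 1) * (2 * m * y - x) + x ↔ 1 + x < 2 * (m + 1) * y := by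
    rw [show (m + 1) * (2 * m * y - x) + x = m * (2 * (m + 1) * y - x) by ring,
      lt_mul_iff_one_lt_right hm']
    constructor <;> intro h <;> linarith
  rw [a1, a2, a3]

theorem convex_gapRegion (m : ℕ) (u v η : ℝ) : Convex ℝ (gapRegion m u v η) := by
  intro p hp q hq a b ha hb hab
  have := convex_indexRegion m u v η hp hq ha hb hab
  simp only [gapRegion, Set.mem_ofPred_eq]
  convert this using 1
  simp only [Prod.fst_add, Prod.snd_add, Prod.smul_fst, Prod.smul_snd, smul_eq_mul, Prod.smul_mk,
    Prod.mk_add_mk]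
  ring_nf

theorem measurableSet_gapRegion (m : ℕ) (u v η : ℝ) : MeasurableSet (gapRegion m u v η) := by
  have hf : Measurable fun p : ℝ × ℝ =>
    ((1 : ℝ) * p.1 + 0 * p.2, -1 * p.1 + 2 * m * p.2) := by fun_prop
  exact hf (measurableSet_indexRegion m u v η)

theorem gapRegion_subset {m : ℕ} (hm : 0 < m) (u v η : ℝ) :
    gapRegion m u v η ⊆ Set.Ioc 0 1 ×ˢ Set.Ioc 0 1 := by
  rintro ⟨x, y⟩ hp
  rw [mem_gapRegion hm] at hp
  obtain ⟨-, ⟨h1, h2⟩, h3, h4⟩ := hp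
  have hm' : (1 : ℝ) ≤ m := by exact_mod_cast hm
  have hy : 0 < y := by linarith
  have hmy : y ≤ m * y := le_mul_of_one_le_left hy.le hm'
  refine ⟨⟨?_, h1⟩, hy, ?_⟩ <;> simp only <;> nlinarith

theorem volume_gapRegion {m : ℕ} (hm : 0 < m) (u v η : ℝ) :
    volume.real (gapRegion m u v η) = volume.real (indexRegion m u v η) / (2 * m) := by
  have hm' : (0 : ℝ) < m := by exact_mod_cast hm
  rw [measureReal_def, gapRegion, volume_preimage_linear_prod _ _ _ _ (by simp; positivity)
    (measurableSet_indexRegion m u v η), ENNReal.toReal_mul,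
    ENNReal.toReal_ofReal (abs_nonneg _), measureReal_def, abs_of_pos (by simp; positivity)]
  field_simp
  simp

theorem scaled_mem_gapRegion {m : ℕ} (hm : 0 < m) {u v η : ℝ} {Q x y : ℕ} (hQ : 0 < Q) :
    ((x : ℝ) / Q, (y : ℝ) / Q) ∈ gapRegion m u v η ↔
      ((x : ℝ) / Q ∈ Set.Ioo (u - η) (u + η) ∧
        (2 * m * y - x : ℝ) / Q ∈ Set.Ioo (v - η) (v + η)) ∧
      (x ≤ Q ∧ 2 * m * y ≤ Q + x) ∧ Q < x + 2 * y ∧ Q + x < 2 * (m + 1) * y := by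
  have hQ' : (0 : ℝ) < Q := by exact_mod_cast hQ
  rw [mem_gapRegion hm]
  have e0 : 2 * (m : ℝ) * (y / Q) - x / Q = (2 * m * y - x : ℝ) / Q := by ring
  have e1 : (x : ℝ) / Q ≤ 1 ↔ x ≤ Q := by rw [div_le_one hQ']; norm_cast
  have e2 : 2 * (m : ℝ) * (y / Q) ≤ 1 + x / Q ↔ 2 * m * y ≤ Q + x := by
    rw [← mul_le_mul_iff_left₀ hQ']
    rw [show 2 * (m : ℝ) * (y / Q) * Q = 2 * m * y by field_simp,
      show (1 + x / Q : ℝ) * Q = Q + x by field_simp]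
    norm_cast
  have e3 : (1 : ℝ) < x / Q + 2 * (y / Q) ↔ Q < x + 2 * y := by
    rw [← mul_lt_mul_iff_left₀ hQ', show (x / Q + 2 * (y / Q) : ℝ) * Q = x + 2 * y by field_simp,
      one_mul]
    norm_cast
  have e4 : (1 : ℝ) + x / Q < 2 * (m + 1) * (y / Q) ↔ Q + x < 2 * (m + 1) * y := by
    rw [← mul_lt_mul_iff_left₀ hQ', show (1 + x / Q : ℝ) * Q = Q + x by field_simp,
      show 2 * ((m : ℝ) + 1) * (y / Q) * Q = 2 * (m + 1) * y by field_simp]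
    norm_cast
  rw [e0, e1, e2, e3, e4]

open Classical in
/-- The lattice points are sorted by `m = ⌊(Q + x) / (2 y)⌋`. -/
theorem card_gapPoints_filter_eq_tsum (k : ℕ) {Q : ℕ} (hQ : 0 < Q) (u v η : ℝ) :
    (((gapPoints k Q).filter (fun p => (p.1 : ℝ) / Q ∈ Set.Ioo (u - η) (u + η) ∧
      (nextDen Q p : ℝ) / Q ∈ Set.Ioo (v - η) (v + η))).card : ℝ) =
      ∑' m : ℕ+, (parityCount (gapRegion m u v η) k Q : ℝ) := by
  obtain ⟨G, hG⟩ : ∃ G, G = (gapPoints k Q).filter (fun p => (p.1 : ℝ) / Q ∈ Set.Ioo (u - η) (u + η) ∧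
      (nextDen Q p : ℝ) / Q ∈ Set.Ioo (v - η) (v + η)) := ⟨_, rfl⟩
  rw [← hG]
  have hfib : ∀ m : ℕ+, parityCount (gapRegion m u v η) k Q =
      (G.filter (fun p => ((Q + p.1) / (2 * p.2)).toPNat' = m)).card := by
    intro m
    rw [parityCount]
    congr 1
    ext ⟨x, y⟩
    simp only [hG, Finset.mem_filter, mem_gapPoints, Finset.mem_product, Finset.mem_Icc]
    rw [scaled_mem_gapRegion m.pos hQ]
    constructor
    · rintro ⟨⟨⟨hx, hxQ⟩, hy, hyQ⟩, hk, ⟨⟨h1, h2⟩, ⟨-, h3⟩, h4, h5⟩, hc⟩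
      have hdiv : (Q + x) / (2 * y) = m := by
        rw [Nat.div_eq_iff (by omega)]
        have : 2 * ((m : ℕ) + 1) * y = m * (2 * y) + 2 * y := by ring
        have : 2 * (m : ℕ) * y = m * (2 * y) := by ring
        omega
      have hp : (x, y) ∈ gapPoints k Q := by
        rw [mem_gapPoints]
        refine ⟨⟨hx, hxQ⟩, ⟨hy, hyQ⟩, hk, hc, h4, ?_⟩
        have : 1 ≤ (Q + x) / (2 * y) := by rw [hdiv]; exact m.pos
        exact (Nat.one_le_div_iff (by omega)).1 this
      refine ⟨⟨mem_gapPoints.1 hp, h1, ?_⟩, ?_⟩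
      · have := (nextDen_spec hp).2.2.2
        simp only [hdiv] at this
        have h' : (nextDen Q (x, y) : ℝ) = 2 * m * y - x := by exact_mod_cast this
        rw [h']; exact h2
      · rw [hdiv]; exact PNat.coe_toPNat' m
    · rintro ⟨⟨hp, h1, h2⟩, h3⟩
      have hp' : (x, y) ∈ gapPoints k Q := mem_gapPoints.2 hp
      obtain ⟨⟨hx, hxQ⟩, ⟨hy, hyQ⟩, hk, hc, h4, h5⟩ := hp
      have hdiv : (Q + x) / (2 * y) = m := by
        rw [← h3, Nat.toPNat'_coe, if_pos (Nat.div_pos h5 (by omega))]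
      have := (nextDen_spec hp').2.2.2
      simp only [hdiv] at this
      have h' : (nextDen Q (x, y) : ℝ) = 2 * m * y - x := by exact_mod_cast this
      rw [h'] at h2
      refine ⟨⟨⟨hx, hxQ⟩, hy, hyQ⟩, hk, ⟨⟨h1, h2⟩, ⟨hxQ, ?_⟩, h4, ?_⟩, hc⟩
      · have := Nat.div_mul_le_self (Q + x) (2 * y)
        rw [hdiv] at this
        linarith
      · have : Q + x < ((m : ℕ) + 1) * (2 * y) := by
          rw [← hdiv]; exact (Nat.div_lt_iff_lt_mul (by omega)).1 (Nat.lt_succ_self _)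
        linarith
  have hzero : ∀ m ∉ G.image (fun p => ((Q + p.1) / (2 * p.2)).toPNat'),
      (parityCount (gapRegion m u v η) k Q : ℝ) = 0 := by
    intro m hm
    rw [hfib, Nat.cast_eq_zero, Finset.card_eq_zero, Finset.filter_eq_empty_iff]
    intro p hp h
    exact hm (Finset.mem_image.2 ⟨p, hp, h⟩)
  rw [tsum_eq_sum hzero,
    Finset.card_eq_sum_card_image (fun p => ((Q + p.1) / (2 * p.2)).toPNat') G]
  push_cast
  exact Finset.sum_congr rfl fun m _ => by rw [hfib]

/-- Here `y ≤ Q / m` and `Q - 2 y < x ≤ Q`, which leaves few points; this dominates the sum over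
`m`. -/
theorem parityCount_gapRegion_le (k : ℕ) {Q : ℕ} (hQ : 0 < Q) {m : ℕ} (hm : 0 < m) (u v η : ℝ) :
    (parityCount (gapRegion m u v η) k Q : ℝ) / (Q : ℝ) ^ 2 ≤ 2 * (1 / (m : ℝ) ^ 2) := by
  have hm' : (0 : ℝ) < m := by exact_mod_cast hm
  have hQ' : (0 : ℝ) < Q := by exact_mod_cast hQ
  have h1 : parityCount (gapRegion m u v η) k Q ≤ (Q / m) * (2 * (Q / m)) := by
    have : (Finset.Icc 1 (Q / m) ×ˢ Finset.range (2 * (Q / m))).card = (Q / m) * (2 * (Q / m)) := by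
      rw [Finset.card_product, Nat.card_Icc, Finset.card_range]; simp
    rw [← this, parityCount]
    refine Finset.card_le_card_of_injOn (fun p => (p.2, Q - p.1)) ?_ ?_
    · rintro ⟨x, y⟩ hp
      simp only [Finset.mem_coe, Finset.mem_filter, Finset.mem_product, Finset.mem_Icc,
        Finset.mem_range, scaled_mem_gapRegion hm hQ] at hp ⊢
      obtain ⟨⟨⟨hx, hxQ⟩, hy, hyQ⟩, -, ⟨-, ⟨-, h3⟩, h4, -⟩, -⟩ := hp
      have : y ≤ Q / m := by
        rw [Nat.le_div_iff_mul_le hm]; nlinarith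
      omega
    · rintro ⟨x, y⟩ hp ⟨x', y'⟩ hp' h
      simp only [Finset.mem_coe, Finset.mem_filter, Finset.mem_product, Finset.mem_Icc] at hp hp'
      simp only [Prod.mk.injEq] at h ⊢
      omega
  have h2 : ((Q / m : ℕ) : ℝ) ≤ Q / m := Nat.cast_div_le
  rw [div_le_iff₀ (by positivity)]
  calc (parityCount (gapRegion m u v η) k Q : ℝ)
      ≤ ((Q / m : ℕ) : ℝ) * (2 * ((Q / m : ℕ) : ℝ)) := by exact_mod_cast h1
    _ ≤ (Q / m : ℝ) * (2 * (Q / m : ℝ)) := by gcongr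
    _ = _ := by ring

theorem summable_two_mul_one_div_pnat_sq : Summable fun m : ℕ+ => 2 * (1 / ((m : ℕ) : ℝ) ^ 2) :=
  ((Real.summable_one_div_nat_pow.2 (by norm_num : 1 < 2)).comp_injective
    PNat.coe_injective).mul_left 2

/-- The region swept by all the points of `gapPoints`. -/
def windowRegion : Set (ℝ × ℝ) :=
  {p | p.1 ∈ Set.Ioc (0 : ℝ) 1 ∧ p.2 ∈ Set.Ioc ((1 - p.1) / 2) ((1 + p.1) / 2)}

theorem windowRegion_subset : windowRegion ⊆ Set.Ioc 0 1 ×ˢ Set.Ioc 0 1 := by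
  rintro ⟨x, y⟩ ⟨⟨h1, h2⟩, h3, h4⟩
  simp only at h1 h2 h3 h4
  exact ⟨⟨h1, h2⟩, by simp only; linarith, by simp only; linarith⟩

theorem convex_windowRegion : Convex ℝ windowRegion := by
  have h0 := convex_setOf_lt_linear 1 0 0
  have h1 := convex_setOf_le_linear 1 0 1
  have h2 := convex_setOf_lt_linear 1 2 1
  have h3 := convex_setOf_le_linear (-1) 2 1
  convert (h0.inter h1).inter (h2.inter h3) using 1
  ext p
  simp only [windowRegion, Set.mem_ofPred_eq, Set.mem_inter_iff, Set.mem_Ioc]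
  constructor
  · rintro ⟨⟨h1, h2⟩, h3, h4⟩; refine ⟨⟨?_, ?_⟩, ?_, ?_⟩ <;> linarith
  · rintro ⟨⟨h1, h2⟩, h3, h4⟩; refine ⟨⟨?_, ?_⟩, ?_, ?_⟩ <;> linarith

theorem measurableSet_windowRegion : MeasurableSet windowRegion := by
  refine MeasurableSet.inter (measurable_fst measurableSet_Ioc) (MeasurableSet.inter ?_ ?_)
  · exact measurableSet_lt (by fun_prop) measurable_snd
  · exact measurableSet_le measurable_snd (by fun_prop)

/-- The area of a set whose vertical sections have affinely varying length. -/
theorem volume_eq_of_sections {S : Set (ℝ × ℝ)} (hS : MeasurableSet S) {p q : ℝ} (α β : ℝ)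
    (hpq : p ≤ q) (hnn : ∀ b ∈ Set.Ioo p q, 0 ≤ α + β * b)
    (hin : ∀ b ∈ Set.Ioo p q, volume (Prod.mk b ⁻¹' S) = ENNReal.ofReal (α + β * b))
    (hout : ∀ b ∉ Set.Icc p q, Prod.mk b ⁻¹' S = ∅) :
    volume S = ENNReal.ofReal (α * (q - p) + β * (q ^ 2 - p ^ 2) / 2) := by
  have h1 : ∀ᵐ b, volume (Prod.mk b ⁻¹' S) =
      (Set.Ioo p q).indicator (fun b => ENNReal.ofReal (α + β * b)) b := by
    filter_upwards [compl_mem_ae_iff.2 (measure_singleton p), compl_mem_ae_iff.2 (measure_singleton q)]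
      with b hbp hbq
    by_cases hb : b ∈ Set.Ioo p q
    · rw [Set.indicator_of_mem hb, hin b hb]
    · rw [Set.indicator_of_notMem hb, hout b, measure_empty]
      exact fun h => hb ⟨lt_of_le_of_ne h.1 (Ne.symm hbp), lt_of_le_of_ne h.2 hbq⟩
  rw [Measure.volume_eq_prod, Measure.prod_apply hS, lintegral_congr_ae h1]
  have hint : IntervalIntegrable (fun b : ℝ => α + β * b) volume p q :=
    (by fun_prop : Continuous fun b : ℝ => α + β * b).intervalIntegrable p q
  rw [lintegral_indicator measurableSet_Ioo,
    ← ofReal_integral_eq_lintegral_ofReal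
      ((intervalIntegrable_iff_integrableOn_Ioo_of_le hpq).1 hint)
      ((ae_restrict_iff' measurableSet_Ioo).2 (Eventually.of_forall hnn)),
    ← integral_Ioc_eq_integral_Ioo, ← intervalIntegral.integral_of_le hpq]
  congr 1
  rw [intervalIntegral.integral_add (by simp) (by
    exact (by fun_prop : Continuous fun b : ℝ => β * b).intervalIntegrable p q)]
  rw [intervalIntegral.integral_const, intervalIntegral.integral_const_mul, integral_id]
  simp only [smul_eq_mul]
  ring

theorem volume_windowRegion : volume.real windowRegion = 1 / 2 := by
  have h := volume_eq_of_sections (p := 0) (q := 1) measurableSet_windowRegion 0 1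
    zero_le_one ?_ ?_ ?_
  · rw [measureReal_def, h, ENNReal.toReal_ofReal] <;> norm_num
  · intro b hb; linarith [hb.1]
  · intro b hb
    have : Prod.mk b ⁻¹' windowRegion = Set.Ioc ((1 - b) / 2) ((1 + b) / 2) := by
      ext y
      simp only [windowRegion, Set.mem_preimage, Set.mem_ofPred_eq]
      exact and_iff_right (Set.Ioo_subset_Ioc_self hb)
    rw [this, Real.volume_Ioc]
    congr 1; ring
  · intro b hb
    ext y
    simp only [windowRegion, Set.mem_preimage, Set.mem_ofPred_eq, Set.mem_empty_iff_false, iff_false]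
    exact fun h => hb (Set.Ioc_subset_Icc_self h.1)

theorem card_gapPoints (k : ℕ) {Q : ℕ} (hQ : 0 < Q) :
    (gapPoints k Q).card = parityCount windowRegion k Q := by
  have hQ' : (0 : ℝ) < Q := by exact_mod_cast hQ
  rw [parityCount]
  congr 1
  ext ⟨x, y⟩
  have e : ((x : ℝ) / Q, (y : ℝ) / Q) ∈ windowRegion ↔
      (0 < x ∧ x ≤ Q) ∧ Q < x + 2 * y ∧ 2 * y ≤ Q + x := by
    have f1 : (0 : ℝ) < x / Q ↔ 0 < x := by rw [lt_div_iff₀ hQ', zero_mul]; norm_cast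
    have f2 : (x : ℝ) / Q ≤ 1 ↔ x ≤ Q := by rw [div_le_one hQ']; norm_cast
    have f3 : (1 - (x : ℝ) / Q) / 2 < y / Q ↔ Q < x + 2 * y := by
      rw [show (1 - (x : ℝ) / Q) / 2 = ((Q - x) / 2) / Q by field_simp, div_lt_div_iff_of_pos_right hQ',
        div_lt_iff₀ two_pos, sub_lt_iff_lt_add]
      norm_cast
      omega
    have f4 : (y : ℝ) / Q ≤ (1 + (x : ℝ) / Q) / 2 ↔ 2 * y ≤ Q + x := by
      rw [show (1 + (x : ℝ) / Q) / 2 = ((Q + x) / 2) / Q by field_simp, div_le_div_iff_of_pos_right hQ',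
        le_div_iff₀ two_pos]
      norm_cast
      omega
    simp only [windowRegion, Set.mem_ofPred_eq, Set.mem_Ioc, f1, f2, f3, f4]
  simp only [gapPoints, Finset.mem_filter, Finset.mem_product, Finset.mem_Icc, e]
  constructor
  · rintro ⟨⟨⟨a, b⟩, c, d⟩, h1, h2, h3, h4⟩; exact ⟨⟨⟨a, b⟩, c, d⟩, h1, ⟨⟨a, b⟩, h3, h4⟩, h2⟩
  · rintro ⟨⟨⟨a, b⟩, c, d⟩, h1, ⟨-, h3, h4⟩, h2⟩; exact ⟨⟨⟨a, b⟩, c, d⟩, h1, h2, h3, h4⟩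

/-- A bounded discrepancy does not affect quadratic growth rates. -/
theorem tendsto_of_bounds {f g : ℕ → ℕ} {l : ℝ} (h1 : ∀ Q, f Q ≤ g Q) (h2 : ∀ Q, g Q ≤ f Q + 1)
    (hg : Tendsto (fun Q => (g Q : ℝ) / (Q : ℝ) ^ 2) atTop (𝓝 l)) :
    Tendsto (fun Q => (f Q : ℝ) / (Q : ℝ) ^ 2) atTop (𝓝 l) := by
  have h0 : Tendsto (fun Q : ℕ => 1 / (Q : ℝ) ^ 2) atTop (𝓝 0) := by
    have := (tendsto_one_div_atTop_nhds_zero_nat (𝕜 := ℝ)).pow 2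
    simpa using this
  refine tendsto_of_tendsto_of_tendsto_of_le_of_le (by simpa using hg.sub h0) hg ?_ ?_
  · intro Q
    have : (g Q : ℝ) ≤ f Q + 1 := by exact_mod_cast h2 Q
    simp only
    rw [inv_eq_one_div, ← sub_div]
    gcongr
    linarith
  · intro Q
    have : (f Q : ℝ) ≤ g Q := by exact_mod_cast h1 Q
    simp only
    gcongr

/-- The inner limit: the limiting proportion of points in a fixed square. -/
theorem tendsto_squareProportion {k : ℕ} (hk : k = 0 ∨ k = 1) (u v η : ℝ) :
    (Summable fun m : ℕ+ => volume.real (indexRegion m u v η) / m) ∧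
    Tendsto (fun Q : ℕ => squareProportion (parityFarey k Q) Q u v η) atTop
      (𝓝 (∑' m : ℕ+, volume.real (indexRegion m u v η) / m)) := by
  classical
  obtain ⟨c, hc, hlim⟩ := exists_tendsto_parityCount hk
  have hterm : ∀ m : ℕ+, Tendsto (fun Q : ℕ =>
      (parityCount (gapRegion m u v η) k Q : ℝ) / (Q : ℝ) ^ 2) atTop
      (𝓝 (c / 2 * (volume.real (indexRegion m u v η) / m))) := by
    intro m
    have := hlim _ (gapRegion_subset m.pos u v η) (convex_gapRegion m u v η)
      (measurableSet_gapRegion m u v η)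
    rw [volume_gapRegion m.pos] at this
    convert this using 2
    rw [mul_comm (2 : ℝ), ← div_div]
    ring
  have hsum : Summable fun m : ℕ+ => c / 2 * (volume.real (indexRegion m u v η) / m) := by
    refine Summable.of_nonneg_of_le (fun m => by positivity) (fun m => ?_)
      summable_two_mul_one_div_pnat_sq
    refine le_of_tendsto (hterm m) ?_
    filter_upwards [eventually_gt_atTop 0] with Q hQ
    exact parityCount_gapRegion_le k hQ m.pos u v η
  refine ⟨(summable_mul_left_iff (by positivity)).1 hsum, ?_⟩
  have hnum : Tendsto (fun Q : ℕ => (((gapPoints k Q).filter (fun p =>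
      (p.1 : ℝ) / Q ∈ Set.Ioo (u - η) (u + η) ∧
      (nextDen Q p : ℝ) / Q ∈ Set.Ioo (v - η) (v + η))).card : ℝ) / (Q : ℝ) ^ 2) atTop
      (𝓝 (∑' m : ℕ+, c / 2 * (volume.real (indexRegion m u v η) / m))) := by
    refine (tendsto_tsum_of_dominated_convergence summable_two_mul_one_div_pnat_sq hterm
      ?_).congr' ?_
    · filter_upwards [eventually_gt_atTop 0] with Q hQ m
      rw [Real.norm_of_nonneg (by positivity)]
      exact parityCount_gapRegion_le k hQ m.pos u v η
    · filter_upwards [eventually_gt_atTop 0] with Q hQ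
      rw [card_gapPoints_filter_eq_tsum k hQ, tsum_div_const]
  have hden : Tendsto (fun Q : ℕ => ((gapPoints k Q).card : ℝ) / (Q : ℝ) ^ 2) atTop
      (𝓝 (c / 2)) := by
    have := hlim _ windowRegion_subset convex_windowRegion measurableSet_windowRegion
    rw [volume_windowRegion, mul_one_div] at this
    refine this.congr' ?_
    filter_upwards [eventually_gt_atTop 0] with Q hQ
    rw [card_gapPoints k hQ]
  have hnum' : Tendsto (fun Q : ℕ => (((consecutivePairs (parityFarey k Q)).filter (fun p =>
      (p.1.den : ℝ) / Q ∈ Set.Ioo (u - η) (u + η) ∧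
      (p.2.den : ℝ) / Q ∈ Set.Ioo (v - η) (v + η))).card : ℝ) / (Q : ℝ) ^ 2) atTop
      (𝓝 (∑' m : ℕ+, c / 2 * (volume.real (indexRegion m u v η) / m))) := by
    have hP := fun Q => card_consecutivePairs_bounds k Q (fun a b =>
      (a : ℝ) / Q ∈ Set.Ioo (u - η) (u + η) ∧ (b : ℝ) / Q ∈ Set.Ioo (v - η) (v + η))
    refine tendsto_of_bounds (fun Q => ?_) (fun Q => ?_) hnum
    · convert (hP Q).1
    · convert (hP Q).2
  have hden' : Tendsto (fun Q : ℕ => ((consecutivePairs (parityFarey k Q)).card : ℝ) / (Q : ℝ) ^ 2)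
      atTop (𝓝 (c / 2)) := by
    refine tendsto_of_bounds (g := fun Q => (gapPoints k Q).card) (fun Q => ?_) (fun Q => ?_) hden
    · simpa using (card_consecutivePairs_bounds k Q (fun _ _ => True)).1
    · simpa using (card_consecutivePairs_bounds k Q (fun _ _ => True)).2
  have hdiv := hnum'.div hden' (by positivity)
  rw [tsum_mul_left, mul_div_cancel_left₀ _ (by positivity)] at hdiv
  refine hdiv.congr' ?_
  filter_upwards [eventually_gt_atTop 0] with Q hQ
  have hQ' : (0 : ℝ) < Q := by exact_mod_cast hQ
  rw [Pi.div_apply, div_div_div_cancel_right₀ (by positivity), squareProportion]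

/-! ### Tangent shapes of the polygons -/

/-- The tangent shape of `indexRegion` at a point, cut out of the square `(-1, 1)²` by those of
the four constraints that are active there. -/
def tangentRegion (j : ℕ) (σ₁ σ₂ σ₃ σ₄ : Prop) : Set (ℝ × ℝ) :=
  {p | (p.1 ∈ Set.Ioo (-1 : ℝ) 1 ∧ p.2 ∈ Set.Ioo (-1 : ℝ) 1) ∧ ((σ₁ → p.1 ≤ 0) ∧ (σ₂ → p.2 ≤ 0)) ∧
    (σ₃ → 0 < ((j : ℝ) + 1) * p.1 + p.2) ∧ (σ₄ → 0 < ((j : ℝ) + 1) * p.2 + p.1)}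

theorem measurableSet_tangentRegion (j : ℕ) (σ₁ σ₂ σ₃ σ₄ : Prop) :
    MeasurableSet (tangentRegion j σ₁ σ₂ σ₃ σ₄) := by
  have himp : ∀ (σ : Prop) (S : Set (ℝ × ℝ)), MeasurableSet S →
      MeasurableSet {p : ℝ × ℝ | σ → p ∈ S} := by
    intro σ S hS
    by_cases h : σ <;> simp [h, hS]
  refine MeasurableSet.inter (MeasurableSet.inter ?_ ?_) (MeasurableSet.inter
    (MeasurableSet.inter ?_ ?_) (MeasurableSet.inter ?_ ?_))
  · exact measurable_fst measurableSet_Ioo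
  · exact measurable_snd measurableSet_Ioo
  · exact himp _ {p | p.1 ≤ 0} (measurableSet_le measurable_fst measurable_const)
  · exact himp _ {p | p.2 ≤ 0} (measurableSet_le measurable_snd measurable_const)
  · exact himp _ {p | 0 < ((j : ℝ) + 1) * p.1 + p.2} (measurableSet_lt measurable_const (by fun_prop))
  · exact himp _ {p | 0 < ((j : ℝ) + 1) * p.2 + p.1} (measurableSet_lt measurable_const (by fun_prop))

theorem eventually_mul_lt_of_nonneg (K : ℝ) {s : ℝ} (hs : 0 ≤ s) :
    ∀ᶠ η in 𝓝[>] (0 : ℝ), s = 0 ∨ K * η < s := by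
  rcases hs.eq_or_lt with h | h
  · exact Eventually.of_forall fun _ => Or.inl h.symm
  · have : Tendsto (fun η : ℝ => K * η) (𝓝[>] 0) (𝓝 0) := by
      have : Tendsto (fun η : ℝ => K * η) (𝓝 0) (𝓝 (K * 0)) :=
        Continuous.tendsto (by fun_prop) 0
      rw [mul_zero] at this
      exact this.mono_left nhdsWithin_le_nhds
    filter_upwards [this.eventually_lt_const h] with η hη using Or.inr hη

theorem volume_preimage_rescale {η : ℝ} (hη : 0 < η) (u v : ℝ) {S : Set (ℝ × ℝ)}
    (hS : MeasurableSet S) :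
    volume {p : ℝ × ℝ | (η⁻¹ * (p.1 - u), η⁻¹ * (p.2 - v)) ∈ S} =
      ENNReal.ofReal (η ^ 2) * volume S := by
  have h := volume_preimage_linear_prod η⁻¹ 0 0 η⁻¹ (by simp [hη.ne']) hS
  have e : |(η⁻¹ * η⁻¹ - 0 * 0)⁻¹| = η ^ 2 := by
    rw [abs_of_pos (by simp; positivity)]; field_simp; simp
  rw [e] at h
  rw [← h, ← measure_preimage_add_right volume (-u, -v)
    {p : ℝ × ℝ | (η⁻¹ * p.1 + 0 * p.2, 0 * p.1 + η⁻¹ * p.2) ∈ S}]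
  congr 1
  ext p
  simp [sub_eq_add_neg]

/-- Below a certain scale, `indexRegion` is a rescaled copy of its tangent shape. -/
theorem eventually_volume_indexRegion (j : ℕ) {u v : ℝ} (hu : u ≤ 1) (hv : v ≤ 1)
    (h3 : (j : ℝ) ≤ (j + 1) * u + v) (h4 : (j : ℝ) ≤ (j + 1) * v + u) :
    ∀ᶠ η in 𝓝[>] (0 : ℝ), volume (indexRegion j u v η) = ENNReal.ofReal (η ^ 2) *
      volume (tangentRegion j (u = 1) (v = 1) ((j + 1) * u + v = (j : ℝ))
        ((j + 1) * v + u = (j : ℝ))) := by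
  have hj : (0 : ℝ) ≤ j := Nat.cast_nonneg j
  filter_upwards [self_mem_nhdsWithin, eventually_mul_lt_of_nonneg 1 (sub_nonneg.2 hu),
    eventually_mul_lt_of_nonneg 1 (sub_nonneg.2 hv),
    eventually_mul_lt_of_nonneg (j + 2) (sub_nonneg.2 h3),
    eventually_mul_lt_of_nonneg (j + 2) (sub_nonneg.2 h4)] with η hη e1 e2 e3 e4
  have hη : 0 < η := hη
  rw [← volume_preimage_rescale hη u v (measurableSet_tangentRegion _ _ _ _ _)]
  congr 1
  ext ⟨s, t⟩
  obtain ⟨a, rfl⟩ : ∃ a, s = u + η * a := ⟨η⁻¹ * (s - u), by field_simp; ring⟩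
  obtain ⟨b, rfl⟩ : ∃ b, t = v + η * b := ⟨η⁻¹ * (t - v), by field_simp; ring⟩
  have f1 : η⁻¹ * (u + η * a - u) = a := by field_simp; ring
  have f2 : η⁻¹ * (v + η * b - v) = b := by field_simp; ring
  simp only [indexRegion, tangentRegion, Set.mem_ofPred_eq, f1, f2, Set.mem_Ioo]
  have g : ∀ w c : ℝ, (w - η < w + η * c ∧ w + η * c < w + η) ↔ -1 < c ∧ c < 1 := by
    intro w c
    constructor
    · rintro ⟨h, h'⟩; constructor <;> nlinarith
    · rintro ⟨h, h'⟩; constructor <;> nlinarith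
  rw [g u a, g v b]
  refine and_congr_right fun ⟨⟨ha, ha'⟩, hb, hb'⟩ => ?_
  have k1 : η * a < η := by nlinarith
  have k2 : η * b < η := by nlinarith
  have k1' : -η < η * a := by nlinarith
  have k2' : -η < η * b := by nlinarith
  have hjη : 0 ≤ j * η := by positivity
  have i1 : ∀ w c : ℝ, (1 - w = 0 ∨ 1 * η < 1 - w) → η * c < η →
      (w + η * c ≤ 1 ↔ (w = 1 → c ≤ 0)) := by
    intro w c h hc
    rcases h with h | h
    · obtain rfl : w = 1 := by linarith
      simp only [true_imp_iff]
      constructor <;> intro h' <;> nlinarith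
    · refine iff_of_true (by linarith) fun h' => ?_
      subst h'; linarith
  have i2 : ∀ w z c d : ℝ, ((j + 1) * w + z - (j : ℝ) = 0 ∨ (j + 2) * η < (j + 1) * w + z - j) →
      -η < η * c → -η < η * d →
      ((j : ℝ) < (j + 1) * (w + η * c) + (z + η * d) ↔
        ((j + 1) * w + z = (j : ℝ) → 0 < (j + 1) * c + d)) := by
    intro w z c d h hc hd
    have hjc : -(j * η) ≤ j * (η * c) := by nlinarith
    have e : (j + 1) * (w + η * c) + (z + η * d) = ((j + 1) * w + z) + η * ((j + 1) * c + d) := by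
      ring
    rcases h with h | h
    · have h' : (j + 1) * w + z = (j : ℝ) := by linarith
      simp only [h', e, true_imp_iff]
      rw [lt_add_iff_pos_right]
      exact mul_pos_iff_of_pos_left hη
    · refine iff_of_true (by nlinarith) fun h' => ?_
      rw [h'] at h
      nlinarith
  rw [i1 u a e1 k1, i1 v b e2 k2, i2 u v a b e3 k1' k2', i2 v u b a e4 k2' k1']

theorem volume_tangentRegion_interior (j : ℕ) :
    volume (tangentRegion j False False False False) = ENNReal.ofReal 4 := by
  rw [volume_eq_of_sections (p := -1) (q := 1) (measurableSet_tangentRegion _ _ _ _ _) 2 0]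
  · norm_num
  · norm_num
  · intro b _; norm_num
  · intro b hb
    have : Prod.mk b ⁻¹' tangentRegion j False False False False = Set.Ioo (-1) 1 := by
      ext y
      simp only [tangentRegion, Set.mem_preimage, Set.mem_ofPred_eq, false_imp_iff, and_true]
      exact and_iff_right hb
    rw [this, Real.volume_Ioo]; norm_num
  · intro b hb
    ext y
    simp only [tangentRegion, Set.mem_preimage, Set.mem_ofPred_eq, Set.mem_empty_iff_false, iff_false]
    exact fun h => hb (Set.Ioo_subset_Icc_self h.1.1)

theorem volume_tangentRegion_side (j : ℕ) :
    volume (tangentRegion j True False False False) = ENNReal.ofReal 2 := by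
  rw [volume_eq_of_sections (p := -1) (q := 0) (measurableSet_tangentRegion _ _ _ _ _) 2 0]
  · norm_num
  · norm_num
  · intro b _; norm_num
  · intro b hb
    have : Prod.mk b ⁻¹' tangentRegion j True False False False = Set.Ioo (-1) 1 := by
      ext y
      simp only [tangentRegion, Set.mem_preimage, Set.mem_ofPred_eq, false_imp_iff, and_true,
        true_imp_iff]
      exact ⟨fun h => h.1.2, fun h => ⟨⟨⟨hb.1, by linarith [hb.2]⟩, h⟩, hb.2.le⟩⟩
    rw [this, Real.volume_Ioo]; norm_num
  · intro b hb
    ext y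
    simp only [tangentRegion, Set.mem_preimage, Set.mem_ofPred_eq, Set.mem_empty_iff_false, iff_false,
      true_imp_iff]
    exact fun h => hb ⟨h.1.1.1.le, h.2.1.1⟩

theorem volume_tangentRegion_one_one (j : ℕ) :
    volume (tangentRegion j True True False False) = ENNReal.ofReal 1 := by
  rw [volume_eq_of_sections (p := -1) (q := 0) (measurableSet_tangentRegion _ _ _ _ _) 1 0]
  · norm_num
  · norm_num
  · intro b _; norm_num
  · intro b hb
    have : Prod.mk b ⁻¹' tangentRegion j True True False False = Set.Ioc (-1) 0 := by
      ext y
      simp only [tangentRegion, Set.mem_preimage, Set.mem_ofPred_eq, false_imp_iff, and_true,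
        true_imp_iff]
      exact ⟨fun h => ⟨h.1.2.1, h.2.2⟩, fun h => ⟨⟨⟨hb.1, by linarith [hb.2]⟩, h.1,
        by linarith [h.2]⟩, hb.2.le, h.2⟩⟩
    rw [this, Real.volume_Ioc]; norm_num
  · intro b hb
    ext y
    simp only [tangentRegion, Set.mem_preimage, Set.mem_ofPred_eq, Set.mem_empty_iff_false, iff_false,
      true_imp_iff]
    exact fun h => hb ⟨h.1.1.1.le, h.2.1.1⟩

theorem edge_section_eq_Ioo (j : ℕ) {a : ℝ} (ha : a < 1) :
    {y : ℝ | y ∈ Set.Ioo (-1 : ℝ) 1 ∧ 0 < ((j : ℝ) + 1) * y + a} = Set.Ioo (-(a / (j + 1))) 1 := by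
  have hj : (0 : ℝ) < j + 1 := by positivity
  have hj1 : (1 : ℝ) ≤ j + 1 := by linarith [Nat.cast_nonneg (α := ℝ) j]
  ext y
  have e : 0 < ((j : ℝ) + 1) * y + a ↔ -(a / (j + 1)) < y := by
    rw [neg_lt, lt_div_iff₀' hj]
    constructor <;> intro h <;> linarith
  have : a / (j + 1) < 1 := by rw [div_lt_one hj]; linarith
  simp only [Set.mem_ofPred_eq, Set.mem_Ioo, e]
  exact ⟨fun h => ⟨h.2, h.1.2⟩, fun h => ⟨⟨by linarith [h.1], h.2⟩, h.1⟩⟩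

theorem volume_edge_section (j : ℕ) {a : ℝ} (ha : a < 1) :
    volume {y : ℝ | y ∈ Set.Ioo (-1 : ℝ) 1 ∧ 0 < ((j : ℝ) + 1) * y + a} =
      ENNReal.ofReal (1 + 1 / ((j : ℝ) + 1) * a) := by
  rw [edge_section_eq_Ioo j ha, Real.volume_Ioo]
  congr 1; ring

theorem edge_length_nonneg (j : ℕ) {a : ℝ} (ha : -1 < a) : 0 ≤ 1 + 1 / ((j : ℝ) + 1) * a := by
  have h1 : 1 / ((j : ℝ) + 1) ≤ 1 := by
    rw [div_le_one (by positivity)]; linarith [Nat.cast_nonneg (α := ℝ) j]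
  have h2 : 0 ≤ 1 / ((j : ℝ) + 1) := by positivity
  nlinarith

theorem volume_tangentRegion_edge (j : ℕ) :
    volume (tangentRegion j False False False True) = ENNReal.ofReal 2 := by
  rw [volume_eq_of_sections (p := -1) (q := 1) (measurableSet_tangentRegion _ _ _ _ _) 1
    (1 / ((j : ℝ) + 1))]
  · norm_num
  · norm_num
  · intro a ha; exact edge_length_nonneg j ha.1
  · intro a ha
    rw [← volume_edge_section j ha.2]
    congr 1
    ext y
    simp only [tangentRegion, Set.mem_preimage, Set.mem_ofPred_eq, false_imp_iff, and_true,
      true_imp_iff, true_and]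
    exact ⟨fun h => ⟨h.1.2, h.2⟩, fun h => ⟨⟨ha, h.1⟩, h.2⟩⟩
  · intro b hb
    ext y
    simp only [tangentRegion, Set.mem_preimage, Set.mem_ofPred_eq, Set.mem_empty_iff_false, iff_false]
    exact fun h => hb (Set.Ioo_subset_Icc_self h.1.1)

theorem volume_tangentRegion_corner (j : ℕ) :
    volume (tangentRegion j True False False True) =
      ENNReal.ofReal (1 - 1 / (2 * ((j : ℝ) + 1))) := by
  rw [volume_eq_of_sections (p := -1) (q := 0) (measurableSet_tangentRegion _ _ _ _ _) 1
    (1 / ((j : ℝ) + 1))]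
  · congr 1
    field_simp
    ring
  · norm_num
  · intro a ha; exact edge_length_nonneg j ha.1
  · intro a ha
    rw [← volume_edge_section j (ha.2.trans one_pos)]
    congr 1
    ext y
    simp only [tangentRegion, Set.mem_preimage, Set.mem_ofPred_eq, false_imp_iff, and_true,
      true_imp_iff, true_and]
    exact ⟨fun h => ⟨h.1.2, h.2.2⟩, fun h => ⟨⟨⟨ha.1, ha.2.trans one_pos⟩, h.1⟩, ha.2.le, h.2⟩⟩
  · intro b hb
    ext y
    simp only [tangentRegion, Set.mem_preimage, Set.mem_ofPred_eq, Set.mem_empty_iff_false, iff_false,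
      true_imp_iff]
    exact fun h => hb ⟨h.1.1.1.le, h.2.1.1⟩

/-- At the vertex on the diagonal both slanted constraints are active, and each of them is the
binding one on one side of `0`. -/
theorem volume_tangentRegion_diagonal (j : ℕ) :
    volume (tangentRegion j False False True True) =
      ENNReal.ofReal (((j : ℝ) + 2) / ((j : ℝ) + 1)) := by
  have hj0 : (0 : ℝ) ≤ j := Nat.cast_nonneg j
  have hj : (0 : ℝ) < j + 1 := by positivity
  have hS := measurableSet_tangentRegion j False False True True
  have hneg : MeasurableSet {p : ℝ × ℝ | p.1 < 0} := measurableSet_lt measurable_fst measurable_const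
  have hmem : ∀ a y : ℝ, (a, y) ∈ tangentRegion j False False True True ↔
      (a ∈ Set.Ioo (-1 : ℝ) 1 ∧ y ∈ Set.Ioo (-1 : ℝ) 1) ∧ 0 < ((j : ℝ) + 1) * a + y ∧
        0 < ((j : ℝ) + 1) * y + a := by
    intro a y
    simp only [tangentRegion, Set.mem_ofPred_eq, false_imp_iff, true_imp_iff, true_and]
  rw [← measure_inter_add_sdiff _ hneg,
    volume_eq_of_sections (p := -(1 / ((j : ℝ) + 1))) (q := 0) (hS.inter hneg) 1 ((j : ℝ) + 1),
    volume_eq_of_sections (p := 0) (q := 1) (hS.diff hneg) 1 (1 / ((j : ℝ) + 1)),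
    ← ENNReal.ofReal_add]
  · congr 1
    field_simp
    ring
  · field_simp
    ring_nf
    norm_num
  · have : 0 ≤ 1 / ((j : ℝ) + 1) := by positivity
    linarith
  · norm_num
  · intro a ha; exact edge_length_nonneg j (by linarith [ha.1])
  · intro a ha
    rw [← volume_edge_section j ha.2]
    congr 1
    ext y
    simp only [Set.mem_preimage, Set.mem_sdiff, hmem, Set.mem_ofPred_eq, not_lt]
    refine ⟨fun h => ⟨h.1.1.2, h.1.2.2⟩,
      fun h => ⟨⟨⟨⟨by linarith [ha.1], ha.2⟩, h.1⟩, ?_, h.2⟩, ha.1.le⟩⟩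
    -- on this side the other constraint is the weaker one
    by_contra hc
    nlinarith [ha.1, h.2, mul_nonneg hj0 ha.1.le]
  · intro a ha
    ext y
    simp only [Set.mem_preimage, Set.mem_sdiff, hmem, Set.mem_ofPred_eq, not_lt,
      Set.mem_empty_iff_false, iff_false]
    exact fun h => ha ⟨h.2, h.1.1.1.2.le⟩
  · have : 0 ≤ 1 / ((j : ℝ) + 1) := by positivity
    linarith
  · intro a ha
    have h1 := mul_lt_mul_of_pos_left ha.1 hj
    have h2 : ((j : ℝ) + 1) * -(1 / ((j : ℝ) + 1)) = -1 := by field_simp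
    linarith
  · intro a ha
    have h1 := mul_lt_mul_of_pos_left ha.1 hj
    have h2 : ((j : ℝ) + 1) * -(1 / ((j : ℝ) + 1)) = -1 := by field_simp
    have : Prod.mk a ⁻¹' (tangentRegion j False False True True ∩ {p | p.1 < 0}) =
        Set.Ioo (-(((j : ℝ) + 1) * a)) 1 := by
      ext y
      simp only [Set.mem_preimage, Set.mem_inter_iff, hmem, Set.mem_ofPred_eq, Set.mem_Ioo]
      constructor
      · rintro ⟨⟨⟨-, -, h3⟩, h4, -⟩, -⟩; exact ⟨by linarith, h3⟩
      · rintro ⟨h3, h4⟩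
        have : 0 ≤ -(j * a) := by nlinarith [ha.2]
        refine ⟨⟨⟨⟨by nlinarith [ha.2], by linarith [ha.2]⟩, by nlinarith [ha.2], h4⟩, by linarith, ?_⟩,
          ha.2⟩
        nlinarith [ha.2]
    rw [this, Real.volume_Ioo]
    congr 1; ring
  · intro a ha
    ext y
    simp only [Set.mem_preimage, Set.mem_inter_iff, hmem, Set.mem_ofPred_eq,
      Set.mem_empty_iff_false, iff_false]
    rintro ⟨⟨⟨-, -, h3⟩, h4, -⟩, h5⟩
    refine ha ⟨?_, h5.le⟩
    rw [neg_le, le_div_iff₀ hj]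
    linarith

/-! ### The local density -/

/-- The limiting proportion of small squares about `(u, v)` filled by `indexRegion j`, written
with the indicators of `fareyDensity`: interior points, points on an edge, and the three kinds of
vertices. -/
noncomputable def localWeight (j : ℕ) (u v : ℝ) : ℝ≥0∞ :=
  charBoth u v (fun z w => z < 1 ∧ (j : ℝ) < (z + w) / (1 - z)) +
  1 / 2 * (charEither u v (fun z w => ((j : ℝ) + 1) * z + w = (j : ℝ) ∧
        ((j : ℝ) - 1) / ((j : ℝ) + 1) < z ∧ z < (j : ℝ) / ((j : ℝ) + 2)) +
      charEither u v (fun z w => z = 1 ∧ ((j : ℝ) - 1) / ((j : ℝ) + 1) < w ∧ w < 1)) +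
  ((2 * (j : ℝ≥0∞) + 1) / (8 * ((j : ℝ≥0∞) + 1)) *
      charEither u v (fun z w => z = ((j : ℝ) - 1) / ((j : ℝ) + 1) ∧ w = 1) +
    ((j : ℝ≥0∞) + 2) / (4 * ((j : ℝ≥0∞) + 1)) *
      charBoth u v (fun z _ => z = (j : ℝ) / ((j : ℝ) + 2)) +
    1 / 4 * charBoth u v (fun z _ => z = 1))

theorem ennreal_div_mul_eq (a b c : ℝ≥0∞) (hb : b ≠ 0) (hb' : b ≠ ⊤) :
    a / (b * c) = 1 / b * (a / c) := by
  rw [div_eq_mul_inv, div_eq_mul_inv, div_eq_mul_inv, ENNReal.mul_inv (Or.inl hb) (Or.inl hb'), one_mul]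
  ring

theorem fareyDensity_eq_tsum (u v : ℝ) :
    fareyDensity u v = ∑' j : ℕ+, 1 / (j : ℝ≥0∞) * localWeight j u v := by
  rw [fareyDensity, ← ENNReal.tsum_add, ← ENNReal.tsum_add]
  refine tsum_congr fun j => ?_
  have hj : ((j : ℕ) : ℝ≥0∞) ≠ 0 := by exact_mod_cast j.pos.ne'
  have hj' : ((j : ℕ) : ℝ≥0∞) ≠ ⊤ := ENNReal.natCast_ne_top _
  rw [localWeight, mul_comm (2 : ℝ≥0∞) (j : ℝ≥0∞), ennreal_div_mul_eq 1 _ 2 hj hj',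
    show (8 : ℝ≥0∞) * (j : ℕ) * ((j : ℕ) + 1) = (j : ℕ) * (8 * ((j : ℕ) + 1)) by ring,
    show (4 : ℝ≥0∞) * (j : ℕ) * ((j : ℕ) + 1) = (j : ℕ) * (4 * ((j : ℕ) + 1)) by ring,
    mul_comm (4 : ℝ≥0∞) (j : ℝ≥0∞),
    ennreal_div_mul_eq _ _ _ hj hj', ennreal_div_mul_eq _ _ _ hj hj', ennreal_div_mul_eq 1 _ 4 hj hj']
  ring

theorem charBoth_comm (u v : ℝ) (P : ℝ → ℝ → Prop) : charBoth u v P = charBoth v u P := by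
  rw [charBoth, charBoth]
  congr 1
  exact propext and_comm

theorem charEither_comm (u v : ℝ) (P : ℝ → ℝ → Prop) : charEither u v P = charEither v u P := by
  rw [charEither, charEither]
  congr 1
  exact propext or_comm

theorem localWeight_comm (j : ℕ) (u v : ℝ) : localWeight j u v = localWeight j v u := by
  simp only [localWeight, charBoth_comm u v, charEither_comm u v]

theorem volume_indexRegion_comm (j : ℕ) (u v η : ℝ) :
    volume (indexRegion j u v η) = volume (indexRegion j v u η) := by
  rw [Measure.volume_eq_prod, ← (Measure.measurePreserving_swap (μ := volume) (ν := volume)).measure_preimage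
    (measurableSet_indexRegion j v u η).nullMeasurableSet]
  congr 1
  ext ⟨s, t⟩
  simp only [indexRegion, Set.mem_ofPred_eq, Set.mem_preimage, Prod.swap_prod_mk]
  tauto

section Conditions

variable {j : ℕ} {u v : ℝ}

theorem lt_div_one_sub_iff {u v : ℝ} (hu : u < 1) :
    (j : ℝ) < (u + v) / (1 - u) ↔ (j : ℝ) < (j + 1) * u + v := by
  rw [lt_div_iff₀ (by linarith)]
  constructor <;> intro h <;> linarith

theorem interior_condition_iff :
    ((u < 1 ∧ (j : ℝ) < (u + v) / (1 - u)) ∧ (v < 1 ∧ (j : ℝ) < (v + u) / (1 - v))) ↔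
      (u < 1 ∧ v < 1) ∧ (j : ℝ) < (j + 1) * u + v ∧ (j : ℝ) < (j + 1) * v + u := by
  constructor
  · rintro ⟨⟨h1, h2⟩, h3, h4⟩
    exact ⟨⟨h1, h3⟩, (lt_div_one_sub_iff h1).1 h2, (lt_div_one_sub_iff h3).1 h4⟩
  · rintro ⟨⟨h1, h3⟩, h2, h4⟩
    exact ⟨⟨h1, (lt_div_one_sub_iff h1).2 h2⟩, h3, (lt_div_one_sub_iff h3).2 h4⟩

theorem charBoth_interior (hvu : v ≤ u) :
    charBoth u v (fun z w => z < 1 ∧ (j : ℝ) < (z + w) / (1 - z)) =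
      open Classical in if u < 1 ∧ (j : ℝ) < (j + 1) * v + u then 1 else 0 := by
  rw [charBoth]
  congr 1
  have hj : (j : ℝ) * v ≤ j * u := mul_le_mul_of_nonneg_left hvu (Nat.cast_nonneg j)
  refine propext (interior_condition_iff.trans
    ⟨fun h => ⟨h.1.1, h.2.2⟩, fun h => ⟨⟨h.1, by linarith [h.1]⟩, ?_, h.2⟩⟩)
  linarith [h.2]

theorem charEither_edge (hvu : v ≤ u) :
    charEither u v (fun z w => ((j : ℝ) + 1) * z + w = (j : ℝ) ∧
      ((j : ℝ) - 1) / ((j : ℝ) + 1) < z ∧ z < (j : ℝ) / ((j : ℝ) + 2)) =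
      open Classical in if (j + 1) * v + u = (j : ℝ) ∧ v < u ∧ u < 1 then 1 else 0 := by
  rw [charEither]
  congr 1
  have hj0 : (0 : ℝ) ≤ j := Nat.cast_nonneg j
  have hj : (j : ℝ) * v ≤ j * u := mul_le_mul_of_nonneg_left hvu hj0
  have e1 : ∀ z : ℝ, ((j : ℝ) - 1) / ((j : ℝ) + 1) < z ↔ (j : ℝ) - 1 < z * (j + 1) :=
    fun z => div_lt_iff₀ (by positivity)
  have e2 : ∀ z : ℝ, z < (j : ℝ) / ((j : ℝ) + 2) ↔ z * (j + 2) < j :=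
    fun z => lt_div_iff₀ (by positivity)
  simp only [e1, e2]
  refine propext ⟨?_, ?_⟩
  · rintro (⟨h1, h2, h3⟩ | ⟨h1, h2, h3⟩)
    · -- the larger coordinate cannot lie on the lower half of the edge
      exact absurd h3 (by linarith)
    · exact ⟨h1, by linarith, by linarith⟩
  · rintro ⟨h1, h2, h3⟩
    exact Or.inr ⟨h1, by linarith, by linarith⟩

theorem charEither_side (hvu : v ≤ u) (hu : u ≤ 1) :
    charEither u v (fun z w => z = 1 ∧ ((j : ℝ) - 1) / ((j : ℝ) + 1) < w ∧ w < 1) =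
      open Classical in if u = 1 ∧ v < 1 ∧ (j : ℝ) < (j + 1) * v + u then 1 else 0 := by
  rw [charEither]
  congr 1
  have e1 : ∀ z : ℝ, ((j : ℝ) - 1) / ((j : ℝ) + 1) < z ↔ (j : ℝ) - 1 < z * (j + 1) :=
    fun z => div_lt_iff₀ (by positivity)
  simp only [e1]
  refine propext ⟨?_, ?_⟩
  · rintro (⟨h1, h2, h3⟩ | ⟨h1, h2, h3⟩)
    · exact ⟨h1, h3, by linarith⟩
    · linarith
  · rintro ⟨h1, h2, h3⟩
    exact Or.inl ⟨h1, by linarith, h2⟩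

theorem charEither_corner (hvu : v ≤ u) (hu : u ≤ 1) :
    charEither u v (fun z w => z = ((j : ℝ) - 1) / ((j : ℝ) + 1) ∧ w = 1) =
      open Classical in if u = 1 ∧ (j + 1) * v + u = (j : ℝ) then 1 else 0 := by
  rw [charEither]
  congr 1
  have e1 : ∀ z : ℝ, z = ((j : ℝ) - 1) / ((j : ℝ) + 1) ↔ z * (j + 1) = (j : ℝ) - 1 :=
    fun z => eq_div_iff (by positivity)
  simp only [e1]
  refine propext ⟨?_, ?_⟩
  · rintro (⟨h1, h2⟩ | ⟨h1, h2⟩)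
    · obtain rfl : u = 1 := by linarith
      linarith
    · exact ⟨h2, by linarith⟩
  · rintro ⟨h1, h2⟩
    exact Or.inr ⟨by linarith, h1⟩

theorem charBoth_diagonal :
    charBoth u v (fun z _ => z = (j : ℝ) / ((j : ℝ) + 2)) =
      open Classical in if u = v ∧ (j + 1) * v + u = (j : ℝ) then 1 else 0 := by
  rw [charBoth]
  congr 1
  have e1 : ∀ z : ℝ, z = (j : ℝ) / ((j : ℝ) + 2) ↔ z * (j + 2) = (j : ℝ) :=
    fun z => eq_div_iff (by positivity)
  refine propext ⟨?_, ?_⟩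
  · rintro ⟨h1, h2⟩
    refine ⟨h1.trans h2.symm, ?_⟩
    rw [h1.trans h2.symm]
    linarith [(e1 v).1 h2]
  · rintro ⟨rfl, h2⟩
    have : u = (j : ℝ) / ((j : ℝ) + 2) := (e1 u).2 (by linarith)
    exact ⟨this, this⟩

theorem charBoth_one (hvu : v ≤ u) (hu : u ≤ 1) :
    charBoth u v (fun z _ => z = 1) = open Classical in if v = 1 then 1 else 0 := by
  rw [charBoth]
  congr 1
  exact propext ⟨fun h => h.2, fun h => ⟨by linarith, h⟩⟩

end Conditions

theorem tendsto_volume_div_of_tangent {j : ℕ} {u v V : ℝ} {σ₁ σ₂ σ₃ σ₄ : Prop} (hu : u ≤ 1) (hv : v ≤ 1)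
    (h3 : (j : ℝ) ≤ (j + 1) * u + v) (h4 : (j : ℝ) ≤ (j + 1) * v + u)
    (s1 : u = 1 ↔ σ₁) (s2 : v = 1 ↔ σ₂) (s3 : (j + 1) * u + v = (j : ℝ) ↔ σ₃)
    (s4 : (j + 1) * v + u = (j : ℝ) ↔ σ₄)
    (hV : volume (tangentRegion j σ₁ σ₂ σ₃ σ₄) = ENNReal.ofReal V) :
    Tendsto (fun η : ℝ => volume (indexRegion j u v η) / ENNReal.ofReal ((2 * η) ^ 2)) (𝓝[>] 0)
      (𝓝 (ENNReal.ofReal (V / 4))) := by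
  refine tendsto_const_nhds.congr' ?_
  filter_upwards [eventually_volume_indexRegion j hu hv h3 h4, self_mem_nhdsWithin] with η h hη
  have hη : 0 < η := hη
  rw [h]
  simp only [s1, s2, s3, s4, hV]
  rw [← ENNReal.ofReal_mul (by positivity), ← ENNReal.ofReal_div_of_pos (by positivity)]
  congr 1
  field_simp
  norm_num

theorem eventually_indexRegion_eq_empty {j : ℕ} {u v : ℝ} (h : (j + 1) * v + u < (j : ℝ)) :
    ∀ᶠ η in 𝓝[>] (0 : ℝ), indexRegion j u v η = ∅ := by
  filter_upwards [eventually_mul_lt_of_nonneg (j + 2) (sub_nonneg.2 h.le)] with η e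
  have e := e.resolve_left (by linarith)
  ext ⟨s, t⟩
  simp only [indexRegion, Set.mem_ofPred_eq, Set.mem_Ioo, Set.mem_empty_iff_false, iff_false]
  rintro ⟨⟨⟨-, h1⟩, -, h2⟩, -, -, h3⟩
  have := mul_lt_mul_of_pos_left h2 (by positivity : (0 : ℝ) < j + 1)
  linarith

/-- By symmetry the point is taken below the diagonal, where the constraint
`m (1 - y) ≤ x + y` is the stronger of the two slanted ones. -/
theorem tendsto_volume_indexRegion_of_le {j : ℕ} (hj1 : 0 < j) {u v : ℝ} (hu : u ≤ 1) (hvu : v ≤ u) :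
    Tendsto (fun η : ℝ => volume (indexRegion j u v η) / ENNReal.ofReal ((2 * η) ^ 2)) (𝓝[>] 0)
      (𝓝 (localWeight j u v)) := by
  have hj0 : (0 : ℝ) ≤ j := Nat.cast_nonneg j
  have hj : (j : ℝ) * v ≤ j * u := mul_le_mul_of_nonneg_left hvu hj0
  have hv : v ≤ 1 := hvu.trans hu
  rw [localWeight, charBoth_interior hvu, charEither_edge hvu, charEither_side hvu hu,
    charEither_corner hvu hu, charBoth_diagonal, charBoth_one hvu hu]
  rcases lt_trichotomy ((j + 1) * v + u) (j : ℝ) with h | h | h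
  · have n1 : ¬ ((j : ℝ) < (j + 1) * v + u) := h.not_gt
    have n2 : ¬ ((j + 1) * v + u = (j : ℝ)) := h.ne
    have n3 : v ≠ 1 := by rintro rfl; linarith
    simp only [n1, n2, n3, false_and, and_false, if_false, mul_zero, add_zero]
    refine tendsto_const_nhds.congr' ?_
    filter_upwards [eventually_indexRegion_eq_empty h] with η hη
    simp [hη]
  · have n1 : ¬ ((j : ℝ) < (j + 1) * v + u) := h.not_gt
    have n3 : v ≠ 1 := by rintro rfl; linarith
    rcases hvu.eq_or_lt with rfl | hlt
    · convert tendsto_volume_div_of_tangent hv hv h.ge h.ge (iff_false_intro n3) (iff_false_intro n3)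
        (iff_true_intro h) (iff_true_intro h) (volume_tangentRegion_diagonal j) using 2
      simp only [h, n3, lt_irrefl, and_false, false_and, if_false, and_self, if_true,
        mul_zero, add_zero, zero_add, mul_one]
      rw [div_div, ENNReal.ofReal_div_of_pos (by positivity), ENNReal.ofReal_mul (by positivity),
        ENNReal.ofReal_add hj0 two_pos.le, ENNReal.ofReal_add hj0 one_pos.le, mul_comm (4 : ℝ≥0∞)]
      simp
    · have n4 : (j + 1) * u + v ≠ (j : ℝ) := by
        have := mul_lt_mul_of_pos_left hlt (by exact_mod_cast hj1 : (0 : ℝ) < j)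
        intro h'; linarith
      have n5 : ¬ (u = v) := hlt.ne'
      rcases hu.eq_or_lt with rfl | hu1
      · convert tendsto_volume_div_of_tangent le_rfl hv (by linarith) h.ge (iff_true_intro rfl)
          (iff_false_intro n3) (iff_false_intro n4) (iff_true_intro h)
          (volume_tangentRegion_corner j) using 2
        simp only [h, n3, n5, lt_irrefl, and_false, false_and, if_false, and_self, if_true,
          mul_zero, add_zero, zero_add, mul_one]
        rw [show (1 - 1 / (2 * ((j : ℝ) + 1))) / 4 = (2 * j + 1) / (8 * (j + 1)) by field_simp; ring,
          ENNReal.ofReal_div_of_pos (by positivity), ENNReal.ofReal_mul (by positivity),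
          ENNReal.ofReal_add (by positivity) one_pos.le, ENNReal.ofReal_add hj0 one_pos.le,
          ENNReal.ofReal_mul two_pos.le]
        simp
      · convert tendsto_volume_div_of_tangent hu hv (by linarith) h.ge (iff_false_intro hu1.ne)
          (iff_false_intro n3) (iff_false_intro n4) (iff_true_intro h)
          (volume_tangentRegion_edge j) using 2
        simp only [h, n3, n5, hlt, hu1, hu1.ne, lt_irrefl, and_false, false_and, if_false, and_self,
          if_true, mul_zero, add_zero, zero_add, mul_one]
        rw [show (2 : ℝ) / 4 = 1 / 2 by norm_num, ENNReal.ofReal_div_of_pos two_pos]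
        simp
  · have n2 : ¬ ((j + 1) * v + u = (j : ℝ)) := h.ne'
    have n4 : (j + 1) * u + v ≠ (j : ℝ) := by intro h'; linarith
    rcases hu.eq_or_lt with rfl | hu1
    · rcases hv.eq_or_lt with rfl | hv1
      · convert tendsto_volume_div_of_tangent le_rfl le_rfl h.le h.le (iff_true_intro rfl)
          (iff_true_intro rfl) (iff_false_intro n2) (iff_false_intro n2)
          (volume_tangentRegion_one_one j) using 2
        rw [mul_one] at n2
        simp only [n2, lt_irrefl, and_false, false_and, if_false, if_true,
          mul_zero, add_zero, zero_add, mul_one]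
        rw [ENNReal.ofReal_div_of_pos (by norm_num)]
        simp
      · convert tendsto_volume_div_of_tangent le_rfl hv (by linarith) h.le (iff_true_intro rfl)
          (iff_false_intro hv1.ne) (iff_false_intro n4) (iff_false_intro n2)
          (volume_tangentRegion_side j) using 2
        simp only [h, hv1, hv1.ne, n2, lt_irrefl, and_false, false_and, if_false, if_true, and_self,
          mul_zero, add_zero, zero_add, mul_one]
        rw [show (2 : ℝ) / 4 = 1 / 2 by norm_num, ENNReal.ofReal_div_of_pos two_pos]
        simp
    · have hv1 : v < 1 := hvu.trans_lt hu1
      convert tendsto_volume_div_of_tangent hu hv (by linarith) h.le (iff_false_intro hu1.ne)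
          (iff_false_intro hv1.ne) (iff_false_intro n4) (iff_false_intro n2)
          (volume_tangentRegion_interior j) using 2
      simp only [h, hu1, hu1.ne, hv1.ne, n2, and_false, false_and, if_false, if_true, and_self,
          mul_zero, add_zero]
      norm_num

theorem tendsto_volume_indexRegion {j : ℕ} (hj1 : 0 < j) {u v : ℝ} (hu : u ≤ 1) (hv : v ≤ 1) :
    Tendsto (fun η : ℝ => volume (indexRegion j u v η) / ENNReal.ofReal ((2 * η) ^ 2)) (𝓝[>] 0)
      (𝓝 (localWeight j u v)) := by
  rcases le_total v u with h | h
  · exact tendsto_volume_indexRegion_of_le hj1 hu h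
  · simp only [volume_indexRegion_comm j u v, localWeight_comm j u v]
    exact tendsto_volume_indexRegion_of_le hj1 hv h

theorem volume_indexRegion_ne_top (j : ℕ) (u v η : ℝ) : volume (indexRegion j u v η) ≠ ⊤ := by
  have hsub : indexRegion j u v η ⊆ Set.Ioo (u - η) (u + η) ×ˢ Set.Ioo (v - η) (v + η) :=
    fun p hp => hp.1
  refine ne_top_of_le_ne_top ?_ (measure_mono hsub)
  rw [Measure.volume_eq_prod, Measure.prod_prod, Real.volume_Ioo, Real.volume_Ioo]
  exact ENNReal.mul_ne_top ENNReal.ofReal_ne_top ENNReal.ofReal_ne_top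

theorem ofReal_tsum_volume_div (u v : ℝ) {η : ℝ} (hη : 0 < η)
    (hs : Summable fun m : ℕ+ => volume.real (indexRegion m u v η) / m) :
    ENNReal.ofReal ((∑' m : ℕ+, volume.real (indexRegion m u v η) / m) / (2 * η) ^ 2) =
      ∑' m : ℕ+, 1 / (m : ℝ≥0∞) *
        (volume (indexRegion m u v η) / ENNReal.ofReal ((2 * η) ^ 2)) := by
  rw [ENNReal.ofReal_div_of_pos (by positivity),
    ENNReal.ofReal_tsum_of_nonneg (fun m => by positivity) hs, div_eq_mul_inv,
    ← ENNReal.tsum_mul_right]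
  refine tsum_congr fun m => ?_
  have hm : (0 : ℝ) < m := by exact_mod_cast m.pos
  rw [ENNReal.ofReal_div_of_pos hm, ofReal_measureReal (volume_indexRegion_ne_top _ _ _ _),
    ENNReal.ofReal_natCast]
  simp only [div_eq_mul_inv, one_mul]
  ring

/-- Away from `(1, 1)` only finitely many of the regions come near the point. -/
theorem exists_eventually_indexRegion_eq_empty {u v : ℝ} (hu : u ≤ 1) (hv : v ≤ 1)
    (h : u < 1 ∨ v < 1) :
    ∃ M : ℕ, ∀ᶠ η in 𝓝[>] (0 : ℝ), ∀ m : ℕ, M ≤ m → indexRegion m u v η = ∅ := by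
  wlog hu1 : u < 1 generalizing u v
  · obtain ⟨M, hM⟩ := this hv hu h.symm (h.resolve_left hu1)
    refine ⟨M, hM.mono fun η hη m hm => ?_⟩
    have := hη m hm
    rw [Set.eq_empty_iff_forall_notMem] at this ⊢
    rintro ⟨s, t⟩ hst
    refine this (t, s) ?_
    simp only [indexRegion, Set.mem_ofPred_eq] at hst ⊢
    tauto
  obtain ⟨M, hM⟩ := exists_nat_gt (4 / (1 - u))
  refine ⟨M, ?_⟩
  filter_upwards [eventually_mul_lt_of_nonneg 2 (sub_nonneg.2 hu)] with η e m hm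
  have e := e.resolve_left (by linarith)
  have hm' : (M : ℝ) ≤ m := by exact_mod_cast hm
  have h4 : 4 < m * (1 - u) := by
    rw [div_lt_iff₀ (by linarith)] at hM
    nlinarith
  rw [Set.eq_empty_iff_forall_notMem]
  rintro ⟨s, t⟩ ⟨⟨⟨-, h1⟩, -⟩, ⟨h2, h2'⟩, h3, -⟩
  simp only at h1 h2 h2' h3
  have : (m : ℝ) * (1 - u) / 2 ≤ m * (1 - s) := by
    have : (1 - u) / 2 ≤ 1 - s := by linarith
    have := mul_le_mul_of_nonneg_left this (Nat.cast_nonneg (α := ℝ) m)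
    linarith
  nlinarith

theorem tendsto_tsum_of_eventually_zero {f : ℝ → ℕ+ → ℝ≥0∞} {g : ℕ+ → ℝ≥0∞} {l : Filter ℝ} [l.NeBot]
    (hf : ∀ m, Tendsto (fun η => f η m) l (𝓝 (g m))) (M : ℕ)
    (hM : ∀ᶠ η in l, ∀ m : ℕ+, M ≤ m → f η m = 0) :
    Tendsto (fun η => ∑' m, f η m) l (𝓝 (∑' m, g m)) := by
  have hg : ∀ m : ℕ+, M ≤ m → g m = 0 := by
    intro m hm
    refine tendsto_nhds_unique (hf m) (tendsto_const_nhds.congr' ?_)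
    filter_upwards [hM] with η hη using (hη m hm).symm
  have hmem : ∀ m ∉ Finset.Icc (1 : ℕ+) M.succPNat, M ≤ (m : ℕ) := by
    intro m hm
    rw [Finset.mem_Icc, not_and] at hm
    have := hm one_le
    rw [← PNat.coe_le_coe, Nat.succPNat_coe] at this
    omega
  rw [tsum_eq_sum fun m hm => hg m (hmem m hm)]
  refine (tendsto_finsetSum _ fun m _ => hf m).congr' ?_
  filter_upwards [hM] with η hη
  rw [tsum_eq_sum fun m hm => hη m (hmem m hm)]

/-- If the sum of the limits diverges, partial sums already push the sums to infinity. -/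
theorem tendsto_tsum_of_tsum_eq_top {f : ℝ → ℕ+ → ℝ≥0∞} {g : ℕ+ → ℝ≥0∞} {l : Filter ℝ}
    (hf : ∀ m, Tendsto (fun η => f η m) l (𝓝 (g m))) (hg : ∑' m, g m = ⊤) :
    Tendsto (fun η => ∑' m, f η m) l (𝓝 (∑' m, g m)) := by
  have hsum := (ENNReal.summable (f := g)).hasSum
  rw [hg] at hsum ⊢
  rw [ENNReal.tendsto_nhds_top_iff_nnreal]
  intro x
  obtain ⟨s, hs⟩ := ((ENNReal.tendsto_nhds_top_iff_nnreal.1 hsum) x).exists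
  filter_upwards [(tendsto_finsetSum s fun m _ => hf m).eventually_const_lt hs] with η hη
  exact hη.trans_le (ENNReal.sum_le_tsum s)

theorem tsum_one_div_pnat_eq_top : ∑' m : ℕ+, (1 / (m : ℝ≥0∞)) = ⊤ := by
  by_contra h
  refine Real.not_summable_one_div_natCast ((summable_nat_add_iff 1).1 ?_)
  have h1 := ENNReal.summable_toReal h
  have h2 : Summable fun m : ℕ+ => (1 : ℝ) / ((m : ℕ) : ℝ) := by
    refine h1.congr fun m => ?_
    simp
  exact (Equiv.pnatEquivNat.symm.summable_iff).2 h2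

theorem localWeight_one_one (j : ℕ) : localWeight j 1 1 = 1 / 4 := by
  have hj0 : (0 : ℝ) ≤ j := Nat.cast_nonneg j
  have n2 : ¬ ((j : ℝ) + 1 + 1 = (j : ℝ)) := by intro h; linarith
  rw [localWeight, charBoth_interior le_rfl, charEither_edge le_rfl, charEither_side le_rfl le_rfl,
    charEither_corner le_rfl le_rfl, charBoth_diagonal, charBoth_one le_rfl le_rfl]
  simp only [n2, lt_irrefl, and_false, false_and, if_false, if_true, mul_zero, add_zero, zero_add,
    mul_one]

theorem fareyDensity_one_one : fareyDensity 1 1 = ⊤ := by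
  simp_rw [fareyDensity_eq_tsum, localWeight_one_one, ENNReal.tsum_mul_right,
    tsum_one_div_pnat_eq_top]
  exact ENNReal.top_mul (by simp)

/-- The outer limit: both parities have the local density `fareyDensity`. -/
theorem hasLocalDensity_parityFarey {k : ℕ} (hk : k = 0 ∨ k = 1) {u v : ℝ} (hu : u ≤ 1)
    (hv : v ≤ 1) : HasLocalDensity (parityFarey k) u v (fareyDensity u v) := by
  refine ⟨fun η => ∑' m : ℕ+, volume.real (indexRegion m u v η) / m,
    fun η _ => (tendsto_squareProportion hk u v η).2, ?_⟩
  have hf : ∀ m : ℕ+, Tendsto (fun η : ℝ => 1 / (m : ℝ≥0∞) *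
      (volume (indexRegion m u v η) / ENNReal.ofReal ((2 * η) ^ 2))) (𝓝[>] 0)
      (𝓝 (1 / (m : ℝ≥0∞) * localWeight m u v)) := by
    intro m
    refine ENNReal.Tendsto.const_mul (tendsto_volume_indexRegion m.pos hu hv) (Or.inr ?_)
    simp
  have main : Tendsto (fun η : ℝ => ∑' m : ℕ+, 1 / (m : ℝ≥0∞) *
      (volume (indexRegion m u v η) / ENNReal.ofReal ((2 * η) ^ 2))) (𝓝[>] 0)
      (𝓝 (fareyDensity u v)) := by
    rw [fareyDensity_eq_tsum]
    by_cases h : u < 1 ∨ v < 1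
    · obtain ⟨M, hM⟩ := exists_eventually_indexRegion_eq_empty hu hv h
      refine tendsto_tsum_of_eventually_zero hf M ?_
      filter_upwards [hM] with η hη m hm
      simp [hη m hm]
    · rw [not_or, not_lt, not_lt] at h
      obtain rfl : u = 1 := le_antisymm hu h.1
      obtain rfl : v = 1 := le_antisymm hv h.2
      refine tendsto_tsum_of_tsum_eq_top hf ?_
      rw [← fareyDensity_eq_tsum, fareyDensity_one_one]
  refine main.congr' ?_
  filter_upwards [self_mem_nhdsWithin] with η hη
  exact (ofReal_tsum_volume_div u v hη (tendsto_squareProportion hk u v η).1).symm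

/-! ### Points off the edges of the tessellation -/

theorem exists_pos_add_smul_mem_of_notMem_frontier {S : Set (ℝ × ℝ)} {p : ℝ × ℝ} (hp : p ∈ S)
    (hf : p ∉ frontier S) (d : ℝ × ℝ) : ∃ t : ℝ, 0 < t ∧ p + t • d ∈ S := by
  have hint : p ∈ interior S := by
    by_contra h
    exact hf ⟨subset_closure hp, h⟩
  have hc : Tendsto (fun t : ℝ => p + t • d) (𝓝[>] 0) (𝓝 p) := by
    have : Tendsto (fun t : ℝ => p + t • d) (𝓝 0) (𝓝 (p + (0 : ℝ) • d)) :=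
      Continuous.tendsto (by fun_prop) 0
    rw [zero_smul, add_zero] at this
    exact this.mono_left nhdsWithin_le_nhds
  have h := (hc.eventually (mem_interior_iff_mem_nhds.1 hint)).and self_mem_nhdsWithin
  obtain ⟨t, ht, ht0⟩ := h.exists
  exact ⟨t, ht0, ht⟩

/-- The right and upper sides of the unit square belong to the boundary of `densityQuad 1`. -/
theorem lt_one_of_notMem_frontier {u v : ℝ} (hu : u ∈ Set.Icc (0 : ℝ) 1) (hv : v ∈ Set.Icc (0 : ℝ) 1)
    (h : (u, v) ∉ frontier (densityQuad 1)) : u < 1 ∧ v < 1 := by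
  constructor
  · refine lt_of_le_of_ne hu.2 ?_
    rintro rfl
    have hmem : ((1 : ℝ), v) ∈ densityQuad 1 := by
      refine ⟨hu, hv, ?_, ?_⟩ <;> push_cast <;> linarith [hv.1]
    obtain ⟨t, ht, hS⟩ := exists_pos_add_smul_mem_of_notMem_frontier hmem h (1, 0)
    have := hS.1.2
    simp only [Prod.fst_add, Prod.smul_fst, smul_eq_mul, mul_one] at this
    linarith
  · refine lt_of_le_of_ne hv.2 ?_
    rintro rfl
    have hmem : (u, (1 : ℝ)) ∈ densityQuad 1 := by
      refine ⟨hu, hv, ?_, ?_⟩ <;> push_cast <;> linarith [hu.1]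
    obtain ⟨t, ht, hS⟩ := exists_pos_add_smul_mem_of_notMem_frontier hmem h (0, 1)
    have := hS.2.1.2
    simp only [Prod.snd_add, Prod.smul_snd, smul_eq_mul, mul_one] at this
    linarith

/-- Moving towards the origin from a point on a slanted edge leaves the quadrilateral. -/
theorem ne_of_notMem_frontier {j : ℕ} {u v : ℝ} (hu : u ∈ Set.Icc (0 : ℝ) 1)
    (hv : v ∈ Set.Icc (0 : ℝ) 1) (hvu : v ≤ u)
    (h : (u, v) ∉ frontier (densityQuad j) ∨ (v, u) ∉ frontier (densityQuad j)) :
    (j + 1) * v + u ≠ (j : ℝ) := by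
  intro he
  have hj0 : (0 : ℝ) ≤ j := Nat.cast_nonneg j
  have hj : (j : ℝ) * v ≤ j * u := mul_le_mul_of_nonneg_left hvu hj0
  rcases h with h | h
  · have hmem : (u, v) ∈ densityQuad j := by
      refine ⟨hu, hv, ?_, ?_⟩ <;> simp only <;> linarith
    obtain ⟨t, ht, hS⟩ := exists_pos_add_smul_mem_of_notMem_frontier hmem h (-1, -1)
    have := hS.2.2.2
    simp only [Prod.fst_add, Prod.snd_add, Prod.smul_fst, Prod.smul_snd, smul_eq_mul] at this
    nlinarith
  · have hmem : (v, u) ∈ densityQuad j := by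
      refine ⟨hv, hu, ?_, ?_⟩ <;> simp only <;> linarith
    obtain ⟨t, ht, hS⟩ := exists_pos_add_smul_mem_of_notMem_frontier hmem h (-1, -1)
    have := hS.2.2.1
    simp only [Prod.fst_add, Prod.snd_add, Prod.smul_fst, Prod.smul_snd, smul_eq_mul] at this
    nlinarith

theorem localWeight_of_ne {j : ℕ} {u v : ℝ} (hu : u < 1) (hvu : v ≤ u)
    (h : (j + 1) * v + u ≠ (j : ℝ)) :
    localWeight j u v = charBoth u v (fun z w => z < 1 ∧ (j : ℝ) < (z + w) / (1 - z)) := by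
  rw [localWeight, charEither_edge hvu, charEither_side hvu hu.le,
    charEither_corner hvu hu.le, charBoth_diagonal, charBoth_one hvu hu.le]
  simp only [h, hu.ne, (hvu.trans_lt hu).ne, and_false, false_and, if_false, mul_zero, add_zero]

theorem fareyDensity_of_notMem_frontier {u v : ℝ} (hu : u ∈ Set.Icc (0 : ℝ) 1)
    (hv : v ∈ Set.Icc (0 : ℝ) 1) (h : ∀ j : ℕ, 1 ≤ j → (u, v) ∉ frontier (densityQuad j)) :
    fareyDensity u v =
      ∑' j : {j : ℕ // 1 ≤ j ∧ (j : ℝ) < (u + v) / (1 - u) ∧ (j : ℝ) < (u + v) / (1 - v)},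
        1 / ((j : ℕ) : ℝ≥0∞) := by
  classical
  obtain ⟨hu1, hv1⟩ := lt_one_of_notMem_frontier hu hv (h 1 le_rfl)
  have hw : ∀ j : ℕ+, localWeight j u v =
      charBoth u v (fun z w => z < 1 ∧ ((j : ℕ) : ℝ) < (z + w) / (1 - z)) := by
    intro j
    rcases le_total v u with hvu | huv
    · exact localWeight_of_ne hu1 hvu (ne_of_notMem_frontier hu hv hvu (Or.inl (h j j.pos)))
    · rw [localWeight_comm, charBoth_comm]
      exact localWeight_of_ne hv1 huv (ne_of_notMem_frontier hv hu huv (Or.inr (h j j.pos)))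
  rw [fareyDensity_eq_tsum]
  obtain ⟨s, hs⟩ : ∃ s : Set ℕ,
      s = {j : ℕ | 1 ≤ j ∧ (j : ℝ) < (u + v) / (1 - u) ∧ (j : ℝ) < (u + v) / (1 - v)} := ⟨_, rfl⟩
  have hright : (∑' j : {j : ℕ // 1 ≤ j ∧ (j : ℝ) < (u + v) / (1 - u) ∧
      (j : ℝ) < (u + v) / (1 - v)}, 1 / ((j : ℕ) : ℝ≥0∞)) =
      ∑' j : ℕ, s.indicator (fun j : ℕ => 1 / (j : ℝ≥0∞)) j := by
    rw [← tsum_subtype, hs]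
    rfl
  have hsupp : Function.support (s.indicator (fun j : ℕ => 1 / (j : ℝ≥0∞))) ⊆
      Set.range ((↑) : ℕ+ → ℕ) := by
    intro j hj
    have hj : j ∈ s := Set.mem_of_indicator_ne_zero hj
    rw [hs] at hj
    exact ⟨⟨j, hj.1⟩, rfl⟩
  rw [hright, ← PNat.coe_injective.tsum_eq hsupp]
  refine tsum_congr fun j => ?_
  have hmem : (j : ℕ) ∈ s ↔ ((u < 1 ∧ ((j : ℕ) : ℝ) < (u + v) / (1 - u)) ∧
      (v < 1 ∧ ((j : ℕ) : ℝ) < (v + u) / (1 - v))) := by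
    rw [hs, add_comm v u]
    exact ⟨fun h => ⟨⟨hu1, h.2.1⟩, hv1, h.2.2⟩, fun h => ⟨j.pos, h.1.2, h.2.2⟩⟩
  rw [hw, charBoth, Set.indicator_apply]
  by_cases hj : (j : ℕ) ∈ s
  · rw [if_pos hj, if_pos (hmem.1 hj), mul_one]
  · rw [if_neg hj, if_neg (fun h => hj (hmem.2 h)), mul_zero]

theorem theorem1 (u v : ℝ) (hu : u ∈ Set.Icc (0 : ℝ) 1) (hv : v ∈ Set.Icc (0 : ℝ) 1) :
    HasLocalDensity evenFarey u v (fareyDensity u v) ∧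
    HasLocalDensity oddFarey u v (fareyDensity u v) ∧
    ((∀ j : ℕ, 1 ≤ j → (u, v) ∉ frontier (densityQuad j)) →
      fareyDensity u v =
        ∑' j : {j : ℕ // 1 ≤ j ∧ (j : ℝ) < (u + v) / (1 - u) ∧ (j : ℝ) < (u + v) / (1 - v)},
          1 / ((j : ℕ) : ℝ≥0∞)) :=
  ⟨hasLocalDensity_parityFarey (k := 0) (Or.inl rfl) hu.2 hv.2,
    hasLocalDensity_parityFarey (k := 1) (Or.inr rfl) hu.2 hv.2,
    fareyDensity_of_notMem_frontier hu hv⟩
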